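/- **Conventions.** Let $\mathrm{GL}^+(2)=\{F\in\mathbb R^{2\times2} : \det F>0\}$, and write $\lambda_{\max}\ge\lambda_{\min}>0$ for the ordered singular values and $\lambda_1,\lambda_2$ for the singular values, in any order, of $F\in \mathrm{GL}^+(2)$. A function $W:\mathrm{GL}^+(2)\to\mathbb R$ is extended to $\widehat W:\mathbb R^{2\times2}\to\mathbb R\cup\{+\infty\}$ by $\widehat W=+\infty$ outside $\mathrm{GL}^+(2)$. * $W$ is *rank-one convex* if $\widehat W(tF_1+(1-t)F_2)\le t\,\widehat W(F_1)+(1-t)\,\widehat W(F_2)$ for all $t\in(0,1)$ and all $F_1,F_2\in\mathbb R^{2\times2}$ with $\operatorname{rank}(F_1-F_2)=1$. * $W$ is *quasiconvex* if $\int_\Omega \widehat W(F_0+\nabla\vartheta(x))\,dx\ge|\Omega|\,\widehat W(F_0)$ for every bounded domain $\Omega\subset\mathbb R^2$, every $F_0\in\mathbb R^{2\times 2}$ and every $\vartheta\in W^{1,\infty}_0(\Omega;\mathbb R^2)$ (that is, $\vartheta$ is Lipschitz on $\overline\Omega$ and vanishes on $\partial\Omega$). The integral takes values in $[-\infty,+\infty]$;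 it is read as $+\infty$ if the positive and the negative part of the integrand both have infinite integral. * $\mathfrak M_+$ is the class of all $W:\mathrm{GL}^+(2)\to\mathbb R$ of the form $W(F)=h\bigl(\tfrac{\lambda_1}{\lambda_2}\bigr)+f(\lambda_1\lambda_2)$ with functions $h,f:(0,\infty)\to\mathbb R$ such that $h(t)=h(1/t)$ for all $t>0$ and $h$ is convex on $(1,\infty)$. Such $W$ are automatically objective and isotropic. **Lemma.** The function $W^+_{\rm magic}:\mathrm{GL}^+(2)\to\mathbb R$, $$W^+_{\rm magic}(F)=\frac{\lambda_{\max}}{\lambda_{\min}}-\log\frac{\lambda_{\max}}{\lambda_{\min}}+\log\det F,$$ is rank-one convex, and the following two statements are equivalent: (i) there exists $W\in\mathfrak M_+$ of class $C^2$ on $\mathrm{GL}^+(2)$ that is rank-one convex but not quasiconvex; (ii) $W^+_{\rm magic}$ is not quasiconvex. -/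

import Mathlib

open MeasureTheory Set
open scoped NNReal ENNReal

noncomputable section

namespace PlanarEnergy

/-- Real `n × n` matrices. -/
abbrev Mat (n : ℕ) : Type := Matrix (Fin n) (Fin n) ℝ

/-- `GL⁺(n)`: the matrices with positive determinant. -/
def GLPlus (n : ℕ) : Set (Mat n) := {F | 0 < F.det}

/-- The extension by `+∞` of a function given on `GL⁺(n)` to all matrices. Only the values of `W`
on `GL⁺(n)` enter, so a function `W : GL⁺(n) → ℝ` may be given as a function on all matrices. -/
def extendTop {n : ℕ} (W : Mat n → ℝ) (F : Mat n) : EReal :=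
  open Classical in if F ∈ GLPlus n then (W F : EReal) else ⊤

/-- Rank-one convexity of an extended-valued function of matrices. -/
def RankOneConvexExt {n : ℕ} (W : Mat n → EReal) : Prop :=
  ∀ F₁ F₂ : Mat n, (F₁ - F₂).rank = 1 → ∀ t ∈ Ioo (0 : ℝ) 1,
    W (t • F₁ + (1 - t) • F₂) ≤ (t : EReal) * W F₁ + ((1 - t : ℝ) : EReal) * W F₂

/-- The space `W₀^{1,∞}(Ω; ℝⁿ)` for a bounded domain `Ω`: the Lipschitz functions that vanish on the
boundary of `Ω`, extended by zero outside of `Ω`. -/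
def IsW0OneInfty {n : ℕ} (Ω : Set (Fin n → ℝ)) (θ : (Fin n → ℝ) → (Fin n → ℝ)) : Prop :=
  (∃ L : ℝ≥0, LipschitzWith L θ) ∧ ∀ x, x ∉ Ω → θ x = 0

/-- The gradient matrix `∇θ(x) = (∂ⱼ θᵢ(x))ᵢⱼ`; by Rademacher's theorem it is the (weak) gradient
at almost every point if `θ` is Lipschitz. -/
def grad {n : ℕ} (θ : (Fin n → ℝ) → (Fin n → ℝ)) (x : Fin n → ℝ) : Mat n :=
  LinearMap.toMatrix' (fderiv ℝ θ x : (Fin n → ℝ) →ₗ[ℝ] (Fin n → ℝ))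

/-- The integral of an extended-valued function over `Ω`, that is, the integral of the positive part
minus the integral of the negative part. It is `+∞` whenever the positive part has integral `+∞`,
also in the case `∞ - ∞` in which the integral does not exist, so that a lower bound for it is then
no condition at all. -/
def extIntegral {n : ℕ} (Ω : Set (Fin n → ℝ)) (g : (Fin n → ℝ) → EReal) : EReal :=
  open Classical in
  if ∫⁻ x in Ω, (g x).toENNReal = ⊤ then ⊤
  else ((∫⁻ x in Ω, (g x).toENNReal : ℝ≥0∞) : EReal)
    - ((∫⁻ x in Ω, (-g x).toENNReal : ℝ≥0∞) : EReal)

/-- Quasiconvexity of an extended-valued function of matrices. -/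
def QuasiconvexExt {n : ℕ} (W : Mat n → EReal) : Prop :=
  ∀ Ω : Set (Fin n → ℝ), IsOpen Ω → IsConnected Ω → Bornology.IsBounded Ω →
    ∀ F₀ : Mat n, ∀ θ : (Fin n → ℝ) → (Fin n → ℝ), IsW0OneInfty Ω θ →
      ((volume Ω : ℝ≥0∞) : EReal) * W F₀ ≤ extIntegral Ω (fun x => W (F₀ + grad θ x))

/-- Rank-one convexity of a function on `GL⁺(n)`. -/
def RankOneConvex {n : ℕ} (W : Mat n → ℝ) : Prop := RankOneConvexExt (extendTop W)

/-- Quasiconvexity of a function on `GL⁺(n)`. -/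
def Quasiconvex {n : ℕ} (W : Mat n → ℝ) : Prop := QuasiconvexExt (extendTop W)

open scoped Matrix.Norms.Frobenius in
/-- `W` is of class `C²` on the open set `GL⁺(n)`. -/
def IsC2 {n : ℕ} (W : Mat n → ℝ) : Prop := ContDiffOn ℝ 2 W (GLPlus n)

/-- The larger singular value of a `2 × 2` matrix. -/
def sigmaMax (F : Mat 2) : ℝ := (Matrix.toEuclideanLin F).singularValues 0

/-- The smaller singular value of a `2 × 2` matrix. -/
def sigmaMin (F : Mat 2) : ℝ := (Matrix.toEuclideanLin F).singularValues 1

/-- `W(F) = h(λ₁/λ₂) + f(λ₁λ₂)` on `GL⁺(2)`, where `λ₁, λ₂` are the singular values of `F` in any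
order; in particular `h(t) = h(1/t)`, and `W` is objective and isotropic. -/
def IsVolIsoSplit (W : Mat 2 → ℝ) (h f : ℝ → ℝ) : Prop :=
  (∀ t : ℝ, 0 < t → h t = h (1 / t)) ∧
    ∀ F ∈ GLPlus 2, W F = h (sigmaMax F / sigmaMin F) + f (sigmaMax F * sigmaMin F)

/-- The class `𝔐₊` of volumetric-isochorically split energies with a convex isochoric part. -/
def MPlus : Set (Mat 2 → ℝ) :=
  {W | ∃ h f : ℝ → ℝ, IsVolIsoSplit W h f ∧ ConvexOn ℝ (Ioi 1) h}

/-- `W⁺_magic(F) = λmax/λmin - log (λmax/λmin) + log det F`. -/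
def magicPlus (F : Mat 2) : ℝ :=
  sigmaMax F / sigmaMin F - Real.log (sigmaMax F / sigmaMin F) + Real.log F.det

end PlanarEnergy

end

/-! Write `F` as `z ↦ a z + b z̄`. The singular values are `|a| ± |b|`, and the magic energy becomes
`2 (|a| / (|a| - |b|) + log (|a| - |b|)) - 1`. On a rank-one segment `a` and `b` move with
velocities of equal length, so `|a|²` and `|b|²` are quadratics with the same leading coefficient.
An explicit second derivative then gives rank-one convexity (`convexOn_sqrt_div_add_log`).

The magic energy is of class `C²` and lies in `MPlus`, so it is itself a witness whenever it is not
quasiconvex.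

Conversely, let `W = h(K) + f(det)` be `C²` and rank-one convex with `h` convex on `(1, ∞)`. Scaling
one diagonal entry gives `t² h''(t) + z² f''(z) ≥ 0` with `t` and `z` independent. Hence a single
constant `c = inf t² h''(t) ≥ 0` makes both `h - c (t - log t)` convex on `[1, ∞)` and `f - c log`
convex. The symmetry `h(t) = h(1/t)` forces `h'(1) = 0`, so the first function is also
nondecreasing, and `W - c · magicPlus` is polyconvex (`IsVolIsoSplit.exists_decomposition`). Since
`∇θ` and `det ∇θ` have zero integral, adding a polyconvex energy preserves quasiconvexity
(`Quasiconvex.of_magicPlus`). Thus a quasiconvex magic energy makes every such `W` quasiconvex. -/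

namespace PlanarEnergy

/-! ### Singular values through the conformal and anticonformal parts -/

/-- The complex number `a` in the decomposition `z ↦ a z + b z̄` of a real `2 × 2` matrix. -/
noncomputable def confPart : Mat 2 →ₗ[ℝ] ℂ where
  toFun F := ⟨(F 0 0 + F 1 1) / 2, (F 1 0 - F 0 1) / 2⟩
  map_add' F G := by apply Complex.ext <;> simp <;> ring
  map_smul' c F := by apply Complex.ext <;> simp <;> ring

/-- The complex number `b` in the decomposition `z ↦ a z + b z̄` of a real `2 × 2` matrix. -/
noncomputable def antiPart : Mat 2 →ₗ[ℝ] ℂ where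
  toFun F := ⟨(F 0 0 - F 1 1) / 2, (F 1 0 + F 0 1) / 2⟩
  map_add' F G := by apply Complex.ext <;> simp <;> ring
  map_smul' c F := by apply Complex.ext <;> simp <;> ring

lemma norm_confPart_sq (F : Mat 2) :
    ‖confPart F‖ ^ 2 = ((F 0 0 + F 1 1) ^ 2 + (F 1 0 - F 0 1) ^ 2) / 4 := by
  rw [Complex.sq_norm, Complex.normSq_apply]
  simp [confPart]; ring

lemma norm_antiPart_sq (F : Mat 2) :
    ‖antiPart F‖ ^ 2 = ((F 0 0 - F 1 1) ^ 2 + (F 1 0 + F 0 1) ^ 2) / 4 := by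
  rw [Complex.sq_norm, Complex.normSq_apply]
  simp [antiPart]; ring

lemma det_eq_norm_sq_sub (F : Mat 2) : F.det = ‖confPart F‖ ^ 2 - ‖antiPart F‖ ^ 2 := by
  rw [norm_confPart_sq, norm_antiPart_sq, Matrix.det_fin_two]; ring

lemma sigmaMin_nonneg (F : Mat 2) : 0 ≤ sigmaMin F := LinearMap.singularValues_nonneg _ _

lemma sigmaMin_le_sigmaMax (F : Mat 2) : sigmaMin F ≤ sigmaMax F :=
  LinearMap.singularValues_antitone _ zero_le_one

lemma adjoint_comp_self_toEuclideanLin (F : Mat 2) :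
    (Matrix.toEuclideanLin F).adjoint ∘ₗ Matrix.toEuclideanLin F
      = Matrix.toEuclideanLin (F.transpose * F) := by
  rw [← Matrix.toEuclideanLin_conjTranspose_eq_adjoint, Matrix.conjTranspose_eq_transpose_of_trivial]
  apply LinearMap.ext
  intro x
  simp [Matrix.toLpLin_apply]

lemma sigma_sq_mul (F : Mat 2) : sigmaMax F ^ 2 * sigmaMin F ^ 2 = F.det ^ 2 := by
  have hn : Module.finrank ℝ (EuclideanSpace ℝ (Fin 2)) = 2 := by simp
  have h0 := (Matrix.toEuclideanLin F).sq_singularValues_fin hn 0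
  have h1 := (Matrix.toEuclideanLin F).sq_singularValues_fin hn 1
  have hd := (Matrix.toEuclideanLin F).isSymmetric_adjoint_comp_self.det_eq_prod_eigenvalues hn
  rw [Fin.prod_univ_two] at hd
  simp only [sigmaMax, sigmaMin]
  rw [show ((0 : Fin 2) : ℕ) = 0 from rfl] at h0
  rw [show ((1 : Fin 2) : ℕ) = 1 from rfl] at h1
  rw [h0, h1]
  have : LinearMap.det ((Matrix.toEuclideanLin F).adjoint ∘ₗ Matrix.toEuclideanLin F)
      = F.det ^ 2 := by
    rw [adjoint_comp_self_toEuclideanLin, Matrix.toEuclideanLin_eq_toLin, LinearMap.det_toLin,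
      Matrix.det_mul, Matrix.det_transpose, sq]
  rw [← this, hd]
  simp

lemma sigma_sq_add (F : Mat 2) :
    sigmaMax F ^ 2 + sigmaMin F ^ 2 = F 0 0 ^ 2 + F 0 1 ^ 2 + F 1 0 ^ 2 + F 1 1 ^ 2 := by
  have hn : Module.finrank ℝ (EuclideanSpace ℝ (Fin 2)) = 2 := by simp
  have h0 := (Matrix.toEuclideanLin F).sq_singularValues_fin hn 0
  have h1 := (Matrix.toEuclideanLin F).sq_singularValues_fin hn 1
  have hd := (Matrix.toEuclideanLin F).isSymmetric_adjoint_comp_self.trace_eq_sum_eigenvalues hn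
  rw [Fin.sum_univ_two] at hd
  simp only [sigmaMax, sigmaMin]
  rw [show ((0 : Fin 2) : ℕ) = 0 from rfl] at h0
  rw [show ((1 : Fin 2) : ℕ) = 1 from rfl] at h1
  rw [h0, h1]
  have : LinearMap.trace ℝ _ ((Matrix.toEuclideanLin F).adjoint ∘ₗ Matrix.toEuclideanLin F)
      = F 0 0 ^ 2 + F 0 1 ^ 2 + F 1 0 ^ 2 + F 1 1 ^ 2 := by
    rw [adjoint_comp_self_toEuclideanLin, Matrix.toEuclideanLin_eq_toLin, Matrix.trace_toLin_eq,
      Matrix.trace_fin_two, Matrix.mul_apply, Matrix.mul_apply]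
    simp [Fin.sum_univ_two]; ring
  rw [← this, hd]
  simp

/-- The squares of `σmax ± σmin` are `tr (Fᵀ F) ± 2 det F`, that is `4 |a|²` and `4 |b|²`. The roots
are taken using `0 ≤ σmin ≤ σmax`. -/
lemma sigma_eq {F : Mat 2} (hF : F ∈ GLPlus 2) :
    sigmaMax F = ‖confPart F‖ + ‖antiPart F‖ ∧ sigmaMin F = ‖confPart F‖ - ‖antiPart F‖ := by
  have hF' : 0 < F.det := hF
  have h1 := sigma_sq_mul F
  have h2 := sigma_sq_add F
  have h3 := norm_confPart_sq F
  have h4 := norm_antiPart_sq F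
  have h5 := det_eq_norm_sq_sub F
  have h6 := sigmaMin_nonneg F
  have h7 := sigmaMin_le_sigmaMax F
  set A := ‖confPart F‖
  set B := ‖antiPart F‖
  have hA : 0 ≤ A := norm_nonneg _
  have hB : 0 ≤ B := norm_nonneg _
  have hAB : B ≤ A := by nlinarith
  have hprod : sigmaMax F * sigmaMin F = A ^ 2 - B ^ 2 := by
    rw [← h5]
    rw [← mul_pow] at h1
    exact (sq_eq_sq₀ (mul_nonneg (h6.trans h7) h6) hF'.le).1 h1
  have hsum : sigmaMax F ^ 2 + sigmaMin F ^ 2 = 2 * (A ^ 2 + B ^ 2) := by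
    rw [h2, h3, h4]; ring
  have e1 : sigmaMax F + sigmaMin F = 2 * A :=
    (sq_eq_sq₀ (by linarith) (by linarith)).1 (by linear_combination hsum + 2 * hprod)
  have e2 : sigmaMax F - sigmaMin F = 2 * B :=
    (sq_eq_sq₀ (by linarith) (by linarith)).1 (by linear_combination hsum - 2 * hprod)
  constructor <;> linarith

lemma norm_antiPart_lt {F : Mat 2} (hF : F ∈ GLPlus 2) : ‖antiPart F‖ < ‖confPart F‖ := by
  have hF' : 0 < F.det := hF
  rw [det_eq_norm_sq_sub] at hF'
  exact lt_of_pow_lt_pow_left₀ 2 (norm_nonneg _) (by linarith)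

lemma sigmaMin_pos {F : Mat 2} (hF : F ∈ GLPlus 2) : 0 < sigmaMin F := by
  rw [(sigma_eq hF).2]; linarith [norm_antiPart_lt hF]

lemma sigmaMax_mul_sigmaMin {F : Mat 2} (hF : F ∈ GLPlus 2) :
    sigmaMax F * sigmaMin F = F.det := by
  rw [(sigma_eq hF).1, (sigma_eq hF).2, det_eq_norm_sq_sub]; ring

lemma one_le_sigmaMax_div {F : Mat 2} (hF : F ∈ GLPlus 2) : 1 ≤ sigmaMax F / sigmaMin F :=
  (one_le_div (sigmaMin_pos hF)).2 (sigmaMin_le_sigmaMax F)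

lemma sigmaMax_div_sigmaMin {F : Mat 2} (hF : F ∈ GLPlus 2) :
    sigmaMax F / sigmaMin F = sigmaMax F ^ 2 / F.det := by
  have h := sigmaMin_pos hF
  have h' := h.trans_le (sigmaMin_le_sigmaMax F)
  rw [← sigmaMax_mul_sigmaMin hF]; field_simp

lemma magicPlus_eq {F : Mat 2} (hF : F ∈ GLPlus 2) :
    magicPlus F = 2 * (‖confPart F‖ / (‖confPart F‖ - ‖antiPart F‖)
      + Real.log (‖confPart F‖ - ‖antiPart F‖)) - 1 := by
  have h := sigmaMin_pos hF
  have h' := h.trans_le (sigmaMin_le_sigmaMax F)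
  rw [magicPlus, ← sigmaMax_mul_sigmaMin hF, Real.log_div h'.ne' h.ne', Real.log_mul h'.ne' h.ne']
  rw [(sigma_eq hF).2] at h
  rw [(sigma_eq hF).1, (sigma_eq hF).2]
  field_simp
  ring

/-! ### Rank-one convexity of the magic energy -/

/-- With `A` and `B` the two square roots, equal leading coefficients let the second derivative be
written as a square plus a positive multiple of `k - A'²`, over `(A - B)³`. Strict positivity under
the second root avoids the kink at `B = 0`. -/
lemma convexOn_sqrt_div_add_log {k c₀ c₁ d₀ d₁ : ℝ} (hc : c₁ ^ 2 ≤ k * c₀)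
    (hd : ∀ t ∈ Icc (0 : ℝ) 1, 0 < d₀ + 2 * d₁ * t + k * t ^ 2)
    (hdc : ∀ t ∈ Icc (0 : ℝ) 1, d₀ + 2 * d₁ * t + k * t ^ 2 < c₀ + 2 * c₁ * t + k * t ^ 2) :
    ConvexOn ℝ (Icc 0 1) fun t =>
      √(c₀ + 2 * c₁ * t + k * t ^ 2)
        / (√(c₀ + 2 * c₁ * t + k * t ^ 2) - √(d₀ + 2 * d₁ * t + k * t ^ 2))
      + Real.log (√(c₀ + 2 * c₁ * t + k * t ^ 2) - √(d₀ + 2 * d₁ * t + k * t ^ 2)) := by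
  have hq : ∀ e₀ e₁ t : ℝ, HasDerivAt (fun t => e₀ + 2 * e₁ * t + k * t ^ 2)
      (2 * (e₁ + k * t)) t := fun e₀ e₁ t => by
    have h := (((hasDerivAt_id t).const_mul (2 * e₁)).const_add e₀).add
      (((hasDerivAt_id t).pow 2).const_mul k)
    convert! h using 1
    simp; ring
  have hs : ∀ e₀ e₁ t : ℝ, 0 < e₀ + 2 * e₁ * t + k * t ^ 2 →
      HasDerivAt (fun t => √(e₀ + 2 * e₁ * t + k * t ^ 2))
        ((e₁ + k * t) / √(e₀ + 2 * e₁ * t + k * t ^ 2)) t := fun e₀ e₁ t h => by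
    convert (hq e₀ e₁ t).sqrt h.ne' using 1
    rw [mul_div_mul_left _ _ two_ne_zero]
  have hl : ∀ e₁ t : ℝ, HasDerivAt (fun t => e₁ + k * t) k t := fun e₁ t => by
    simpa using ((hasDerivAt_id t).const_mul k).const_add e₁
  set A : ℝ → ℝ := fun t => √(c₀ + 2 * c₁ * t + k * t ^ 2) with hAdef
  set B : ℝ → ℝ := fun t => √(d₀ + 2 * d₁ * t + k * t ^ 2) with hBdef
  have hB : ∀ t ∈ Icc (0 : ℝ) 1, 0 < B t := fun t ht => Real.sqrt_pos.2 (hd t ht)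
  have hAB : ∀ t ∈ Icc (0 : ℝ) 1, B t < A t := fun t ht =>
    Real.sqrt_lt_sqrt (hd t ht).le (hdc t ht)
  have hA' : ∀ t ∈ Icc (0 : ℝ) 1, HasDerivAt A ((c₁ + k * t) / A t) t := fun t ht =>
    hs _ _ _ ((hd t ht).trans (hdc t ht))
  have hB' : ∀ t ∈ Icc (0 : ℝ) 1, HasDerivAt B ((d₁ + k * t) / B t) t := fun t ht =>
    hs _ _ _ (hd t ht)
  have hf : ∀ t ∈ Icc (0 : ℝ) 1, HasDerivAt (fun t => A t / (A t - B t) + Real.log (A t - B t))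
      ((A t - 2 * B t) * (c₁ + k * t) / A t / (A t - B t) ^ 2
        + (d₁ + k * t) / (A t - B t) ^ 2) t := fun t ht => by
    have h1 := (hB t ht)
    have h2 := sub_pos.2 (hAB t ht)
    have h3 := h1.trans (hAB t ht)
    have := ((hA' t ht).div ((hA' t ht).sub (hB' t ht)) h2.ne').add
      (((hA' t ht).sub (hB' t ht)).log h2.ne')
    convert! this using 1
    simp only [Pi.sub_apply]
    field_simp
    ring
  have hf' : ∀ t ∈ Icc (0 : ℝ) 1, HasDerivAt (fun t =>
      (A t - 2 * B t) * (c₁ + k * t) / A t / (A t - B t) ^ 2 + (d₁ + k * t) / (A t - B t) ^ 2)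
      ((2 * B t * ((c₁ + k * t) / A t - (d₁ + k * t) / B t) ^ 2
        + 2 * (A t - B t) ^ 2 * (k - ((c₁ + k * t) / A t) ^ 2) / A t) / (A t - B t) ^ 3) t :=
    fun t ht => by
    have h1 := (hB t ht)
    have h2 := sub_pos.2 (hAB t ht)
    have h3 := h1.trans (hAB t ht)
    have hsq := ((hA' t ht).sub (hB' t ht)).pow 2
    have h2' : ((A - B) ^ 2) t ≠ 0 := by
      simpa using h2.ne'
    have := (((((hA' t ht).sub ((hB' t ht).const_mul 2)).mul (hl c₁ t)).div (hA' t ht)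
      h3.ne').div hsq h2').add ((hl d₁ t).div hsq h2')
    convert! this using 1
    simp only [Pi.sub_apply, Pi.pow_apply, Pi.mul_apply, Pi.div_apply]
    field_simp
    ring
  refine convexOn_of_hasDerivWithinAt2_nonneg (convex_Icc 0 1)
    (fun t ht => (hf t ht).continuousAt.continuousWithinAt)
    (fun t ht => (hf t (interior_subset ht)).hasDerivWithinAt)
    (fun t ht => (hf' t (interior_subset ht)).hasDerivWithinAt) fun t ht => ?_
  have ht' := interior_subset ht
  have h1 := (hB t ht')
  have h2 := sub_pos.2 (hAB t ht')
  have h3 := h1.trans (hAB t ht')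
  have hAsq : A t ^ 2 = c₀ + 2 * c₁ * t + k * t ^ 2 :=
    Real.sq_sqrt ((hd t ht').trans (hdc t ht')).le
  -- Cleared of denominators, this is exactly `c₁² ≤ k c₀`.
  have h4 : 0 ≤ k - ((c₁ + k * t) / A t) ^ 2 := by
    rw [sub_nonneg, div_pow, div_le_iff₀ (by positivity), hAsq]
    nlinarith
  positivity

lemma det_eq_zero_of_rank_eq_one {H : Mat 2} (h : H.rank = 1) : H.det = 0 := by
  by_contra hne
  have := Matrix.rank_of_isUnit H ((Matrix.isUnit_iff_isUnit_det H).2 (isUnit_iff_ne_zero.2 hne))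
  simp [h] at this

lemma norm_add_smul_sq (z w : ℂ) (t : ℝ) :
    ‖z + t • w‖ ^ 2 = ‖z‖ ^ 2 + 2 * inner ℝ z w * t + ‖w‖ ^ 2 * t ^ 2 := by
  rw [norm_add_sq_real, inner_smul_right, norm_smul, mul_pow, Real.norm_eq_abs, sq_abs]
  ring

/-- The quadratic coefficient in `t` is `det (F₁ - F₂)`. -/
lemma det_segment {F₁ F₂ : Mat 2} (h : (F₁ - F₂).det = 0) (t : ℝ) :
    (t • F₁ + (1 - t) • F₂).det = t * F₁.det + (1 - t) * F₂.det := by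
  rw [Matrix.det_fin_two] at h ⊢
  rw [Matrix.det_fin_two, Matrix.det_fin_two]
  simp at h ⊢
  linear_combination (-t * (1 - t)) * h

lemma magicPlus_segment_le {F₁ F₂ : Mat 2} (h₁ : F₁ ∈ GLPlus 2) (h₂ : F₂ ∈ GLPlus 2)
    (h : (F₁ - F₂).det = 0) {t : ℝ} (ht : t ∈ Icc (0 : ℝ) 1) :
    magicPlus (t • F₁ + (1 - t) • F₂) ≤ t * magicPlus F₁ + (1 - t) * magicPlus F₂ := by
  have h₁' : 0 < F₁.det := h₁
  have h₂' : 0 < F₂.det := h₂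
  set a := confPart F₂
  set b := antiPart F₂
  set α := confPart (F₁ - F₂) with hα
  set β := antiPart (F₁ - F₂) with hβ
  have hk : ‖β‖ ^ 2 = ‖α‖ ^ 2 := by rw [det_eq_norm_sq_sub] at h; linarith
  let S : ℝ → Mat 2 := fun s => s • F₁ + (1 - s) • F₂
  have hSa : ∀ s, confPart (S s) = a + s • α := fun s => by
    simp only [S, hα, map_add, map_smul, map_sub, a]; module
  have hSb : ∀ s, antiPart (S s) = b + s • β := fun s => by
    simp only [S, hβ, map_add, map_smul, map_sub, b]; module
  set c : ℝ → ℝ := fun s => ‖a‖ ^ 2 + 2 * inner ℝ a α * s + ‖α‖ ^ 2 * s ^ 2 with hc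
  set d : ℝ → ℝ := fun s => ‖b‖ ^ 2 + 2 * inner ℝ b β * s + ‖α‖ ^ 2 * s ^ 2 with hd
  have hcS : ∀ s, c s = ‖confPart (S s)‖ ^ 2 := fun s => by rw [hSa, norm_add_smul_sq]
  have hdS : ∀ s, d s = ‖antiPart (S s)‖ ^ 2 := fun s => by rw [hSb, norm_add_smul_sq, hk]
  have hdet : ∀ s, c s - d s = s * F₁.det + (1 - s) * F₂.det := fun s => by
    rw [hcS, hdS, ← det_eq_norm_sq_sub, ← det_segment h]
  have hmin : ∀ s ∈ Icc (0 : ℝ) 1, min F₁.det F₂.det ≤ c s - d s := fun s hs => by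
    rw [hdet]
    nlinarith [min_le_left F₁.det F₂.det, min_le_right F₁.det F₂.det, hs.1, hs.2]
  have hm0 : 0 < min F₁.det F₂.det := lt_min h₁' h₂'
  have hSG : ∀ s ∈ Icc (0 : ℝ) 1, S s ∈ GLPlus 2 := fun s hs => by
    change 0 < (S s).det
    rw [det_eq_norm_sq_sub, ← hcS, ← hdS]
    exact hm0.trans_le (hmin s hs)
  -- The segment may pass through `b = 0`, where `|b|` is not smooth. Replacing `|b|²` by `|b|² +
  -- δ`, with `δ` below the minimal determinant on the segment, keeps `|b|² + δ < |a|²`; the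
  -- inequality survives `δ → 0`.
  let g : ℝ → ℝ → ℝ := fun s δ => √(c s) / (√(c s) - √(d s + δ)) + Real.log (√(c s) - √(d s + δ))
  have hg0 : ∀ s ∈ Icc (0 : ℝ) 1, magicPlus (S s) = 2 * g s 0 - 1 := fun s hs => by
    rw [magicPlus_eq (hSG s hs)]
    simp only [g, add_zero, hcS, hdS, Real.sqrt_sq (norm_nonneg _)]
  have hg : ∀ s ∈ Icc (0 : ℝ) 1, Filter.Tendsto (g s) (nhdsWithin 0 (Ioi 0)) (nhds (g s 0)) :=
    fun s hs => by
    have hne : √(c s) - √(d s + 0) ≠ 0 := by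
      rw [add_zero, hcS, hdS, Real.sqrt_sq (norm_nonneg _), Real.sqrt_sq (norm_nonneg _)]
      linarith [norm_antiPart_lt (hSG s hs)]
    have h0 : ContinuousAt (fun δ => √(c s) - √(d s + δ)) 0 := by fun_prop
    have : ContinuousAt (g s) 0 := (continuousAt_const.div h0 hne).add (h0.log hne)
    exact this.tendsto.mono_left nhdsWithin_le_nhds
  have hconv : ∀ᶠ δ in nhdsWithin (0 : ℝ) (Ioi 0), g t δ ≤ t * g 1 δ + (1 - t) * g 0 δ := by
    filter_upwards [Ioo_mem_nhdsGT hm0] with δ hδ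
    have key := convexOn_sqrt_div_add_log (k := ‖α‖ ^ 2) (c₀ := ‖a‖ ^ 2) (c₁ := inner ℝ a α)
      (d₀ := ‖b‖ ^ 2 + δ) (d₁ := inner ℝ b β) ?_ ?_ ?_
    · have := key.2 (x := 1) (y := 0) (by simp) (by simp) ht.1 (sub_nonneg.2 ht.2) (by ring)
      simp only [smul_eq_mul, mul_one, mul_zero, add_zero] at this
      have e : ∀ s, d s + δ
          = ‖b‖ ^ 2 + δ + 2 * inner ℝ b β * s + ‖α‖ ^ 2 * s ^ 2 := fun s => by
        simp only [hd]; ring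
      simp only [g, e]
      simpa [hc] using this
    · have := abs_real_inner_le_norm a α
      rw [← sq_abs]
      nlinarith [abs_nonneg (inner ℝ a α), norm_nonneg a, norm_nonneg α]
    · intro s _
      have : 0 ≤ d s := by rw [hdS]; positivity
      simp only [hd] at this
      linarith [hδ.1]
    · intro s hs
      have := hmin s hs
      simp only [hd, hc] at this
      linarith [hδ.2]
  have hlim := le_of_tendsto_of_tendsto (hg t ht)
    (((hg 1 (by simp)).const_mul t).add ((hg 0 (by simp)).const_mul (1 - t))) hconv
  have e1 := hg0 1 (by simp)
  have e0 := hg0 0 (by simp)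
  have et := hg0 t ht
  simp only [S, one_smul, sub_self, zero_smul, add_zero, sub_zero, zero_add] at e1 e0 et
  rw [e1, e0, et]
  linarith

lemma RankOneConvex.of_segment {n : ℕ} {W : Mat n → ℝ}
    (h : ∀ F₁ ∈ GLPlus n, ∀ F₂ ∈ GLPlus n, (F₁ - F₂).rank = 1 → ∀ t ∈ Ioo (0 : ℝ) 1,
      t • F₁ + (1 - t) • F₂ ∈ GLPlus n ∧
      W (t • F₁ + (1 - t) • F₂) ≤ t * W F₁ + (1 - t) * W F₂) : RankOneConvex W := by
  intro F₁ F₂ hr t ht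
  have ht1 : (0 : ℝ) < 1 - t := sub_pos.2 ht.2
  have hbot : ∀ (F : Mat n) {s : ℝ}, 0 < s → (s : EReal) * extendTop W F ≠ ⊥ := fun F s hs => by
    unfold extendTop
    split_ifs
    · rw [← EReal.coe_mul]; exact EReal.coe_ne_bot _
    · rw [EReal.coe_mul_top_of_pos hs]; simp
  by_cases h₁ : F₁ ∈ GLPlus n
  · by_cases h₂ : F₂ ∈ GLPlus n
    · obtain ⟨h3, h4⟩ := h F₁ h₁ F₂ h₂ hr t ht
      simp only [extendTop, h₁, h₂, h3, if_true]
      exact_mod_cast h4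
    · have : extendTop W F₂ = ⊤ := by simp [extendTop, h₂]
      rw [this, EReal.coe_mul_top_of_pos ht1, EReal.add_top_of_ne_bot (hbot F₁ ht.1)]
      exact le_top
  · have : extendTop W F₁ = ⊤ := by simp [extendTop, h₁]
    rw [this, EReal.coe_mul_top_of_pos ht.1, EReal.top_add_of_ne_bot (hbot F₂ ht1)]
    exact le_top

theorem rankOneConvex_magicPlus : RankOneConvex magicPlus := by
  refine RankOneConvex.of_segment fun F₁ h₁ F₂ h₂ hr t ht => ?_
  have h := det_eq_zero_of_rank_eq_one hr
  refine ⟨?_, magicPlus_segment_le h₁ h₂ h (Ioo_subset_Icc_self ht)⟩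
  change 0 < (t • F₁ + (1 - t) • F₂).det
  rw [det_segment h]
  have h₁' : 0 < F₁.det := h₁
  have h₂' : 0 < F₂.det := h₂
  have := sub_pos.2 ht.2
  have := ht.1
  positivity

end PlanarEnergy

/-! ### Regularity of the magic energy -/

/-- The derivative `‖x‖ id + x ⊗ x / ‖x‖` has norm at most `2 ‖x‖`, so it extends continuously by
zero. The convention `0⁻¹ = 0` makes the formula correct at the origin. -/
lemma contDiff_one_norm_smul_self (E : Type*) [NormedAddCommGroup E] [InnerProductSpace ℝ E] :
    ContDiff ℝ 1 fun x : E => ‖x‖ • x := by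
  have hd : ∀ x : E, HasFDerivAt (fun x : E => ‖x‖ • x)
      (‖x‖ • ContinuousLinearMap.id ℝ E + (‖x‖⁻¹ • innerSL ℝ x).smulRight x) x := by
    intro x
    rcases eq_or_ne x 0 with rfl | hx
    · simp only [norm_zero, zero_smul, map_zero, smul_zero, zero_add]
      have : (‖(0 : E)‖⁻¹ • innerSL ℝ (0 : E)).smulRight (0 : E) = 0 := by ext; simp
      rw [hasFDerivAt_iff_isLittleO_nhds_zero]
      have h1 : Filter.Tendsto (fun x : E => ‖x‖) (nhds 0) (nhds 0) := by
        simpa using (continuous_norm (E := E)).tendsto 0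
      have h2 := ((Asymptotics.isLittleO_one_iff ℝ).2 h1).smul_isBigO
        (Asymptotics.isBigO_refl (fun x : E => x) (nhds 0))
      simpa using h2
    · have h1 : HasFDerivAt (fun x : E => ‖x‖) (‖x‖⁻¹ • innerSL ℝ x) x := by
        have h2 := (hasStrictFDerivAt_norm_sq x).hasFDerivAt.sqrt (by positivity)
        simp only [Real.sqrt_sq (norm_nonneg _)] at h2
        convert! h2 using 1
        rw [← Nat.cast_smul_eq_nsmul ℝ, smul_smul]
        congr 1
        have := norm_pos_iff.2 hx
        push_cast; field_simp
      exact h1.smul (hasFDerivAt_id x)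
  rw [contDiff_one_iff_hasFDerivAt]
  refine ⟨_, ?_, hd⟩
  rw [continuous_iff_continuousAt]
  intro x
  rcases eq_or_ne x 0 with rfl | hx
  · rw [ContinuousAt]
    simp only [norm_zero, zero_smul, map_zero, smul_zero, zero_add]
    have h0 : (0 : StrongDual ℝ E).smulRight (0 : E) = 0 := by ext; simp
    rw [h0]
    refine squeeze_zero_norm (a := fun x : E => ‖x‖ + ‖x‖) (fun x => ?_) ?_
    · refine (norm_add_le _ _).trans (add_le_add ?_ ?_)
      · rw [norm_smul, norm_norm]
        exact mul_le_of_le_one_right (norm_nonneg _) ContinuousLinearMap.norm_id_le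
      · rw [ContinuousLinearMap.norm_smulRight_apply, norm_smul, innerSL_apply_norm, norm_inv,
          norm_norm]
        rcases eq_or_ne x 0 with rfl | hx
        · simp
        · rw [inv_mul_cancel₀ (norm_ne_zero_iff.2 hx), one_mul]
    · have : Continuous fun x : E => ‖x‖ + ‖x‖ := by fun_prop
      simpa using this.tendsto 0
  · have hx' := norm_ne_zero_iff.2 hx
    have h1 : ContinuousAt (fun x : E => ‖x‖⁻¹ • innerSL ℝ x) x :=
      (continuousAt_id.norm.inv₀ hx').smul (innerSL ℝ).continuous.continuousAt
    refine (continuousAt_id.norm.smul continuousAt_const).add ?_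
    exact ((ContinuousLinearMap.smulRightL ℝ E E).continuous₂.continuousAt).comp
      (h1.prodMk continuousAt_id)

namespace PlanarEnergy

/-- The isochoric part `K - log K` of the magic energy, with `K = (1 + r) / (1 - r)`, in terms of
the ratio `r = |b| / |a|` of the anticonformal to the conformal part. -/
noncomputable def ratioEnergy (r : ℝ) : ℝ := (1 + r) / (1 - r) - Real.log ((1 + r) / (1 - r))

/-- The explicit factor `r` cancels the singular `‖x‖⁻¹` in the gradient of the norm, which is why
`x ↦ ratioEnergy ‖x‖` is smooth enough at conformal matrices. -/
lemma hasDerivAt_ratioEnergy {r : ℝ} (h0 : 0 ≤ r) (h1 : r < 1) :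
    HasDerivAt ratioEnergy (4 * (1 + r) / (1 - r ^ 2) ^ 2 * r) r := by
  have h2 : 0 < 1 - r := sub_pos.2 h1
  have h3 : 0 < 1 + r := by linarith
  have h4 : 1 - r ^ 2 ≠ 0 := by nlinarith
  have hq := ((hasDerivAt_id r).const_add 1).div ((hasDerivAt_id r).const_sub 1) h2.ne'
  have := hq.sub (hq.log (by simp only [Pi.div_apply, id]; positivity))
  convert! this using 1
  simp only [Pi.div_apply, id]
  rw [show 1 - r ^ 2 = (1 - r) * (1 + r) by ring]
  field_simp
  ring

lemma hasFDerivAt_ratioEnergy_norm {x : ℂ} (hx : ‖x‖ < 1) :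
    HasFDerivAt (fun x : ℂ => ratioEnergy ‖x‖)
      ((4 * (1 + ‖x‖) / (1 - ‖x‖ ^ 2) ^ 2) • innerSL ℝ x) x := by
  have h := hasDerivAt_ratioEnergy (norm_nonneg x) hx
  rcases eq_or_ne x 0 with rfl | hx0
  · rw [hasFDerivAt_iff_isLittleO_nhds_zero]
    rw [norm_zero] at h
    have h1 : Filter.Tendsto (fun x : ℂ => ‖x‖) (nhds 0) (nhds 0) := by
      simpa using (continuous_norm (E := ℂ)).tendsto 0
    have h2 := (hasDerivAt_iff_isLittleO_nhds_zero.1 h).comp_tendsto h1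
    refine Asymptotics.IsLittleO.of_norm_right ?_
    simpa [Function.comp_def] using h2
  · have hn := norm_pos_iff.2 hx0
    have h1 : HasFDerivAt (fun x : ℂ => ‖x‖) (‖x‖⁻¹ • innerSL ℝ x) x := by
      have h2 := (hasStrictFDerivAt_norm_sq x).hasFDerivAt.sqrt (by positivity)
      simp only [Real.sqrt_sq (norm_nonneg _)] at h2
      convert! h2 using 1
      rw [← Nat.cast_smul_eq_nsmul ℝ, smul_smul]
      congr 1
      push_cast; field_simp
    convert! h.comp_hasFDerivAt x h1 using 1
    rw [smul_smul]
    congr 1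
    field_simp

lemma contDiffOn_ratioEnergy_norm :
    ContDiffOn ℝ 2 (fun x : ℂ => ratioEnergy ‖x‖) (Metric.ball 0 1) := by
  have hd : ∀ x ∈ Metric.ball (0 : ℂ) 1, HasFDerivAt (fun x : ℂ => ratioEnergy ‖x‖)
      ((4 * (1 + ‖x‖) / (1 - ‖x‖ ^ 2) ^ 2) • innerSL ℝ x) x := fun x hx =>
    hasFDerivAt_ratioEnergy_norm (by simpa using hx)
  rw [show (2 : WithTop ℕ∞) = 1 + 1 from rfl,
    contDiffOn_succ_iff_fderiv_of_isOpen Metric.isOpen_ball]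
  refine ⟨fun x hx => (hd x hx).differentiableAt.differentiableWithinAt, by simp, ?_⟩
  -- The gradient is a smooth multiple of `x + ‖x‖ x`, whose only nonsmooth ingredient is the `C¹`
  -- map `x ↦ ‖x‖ x`.
  have h1 : ContDiffOn ℝ 1 (fun x : ℂ => (4 / (1 - ‖x‖ ^ 2) ^ 2) • innerSL ℝ (x + ‖x‖ • x))
      (Metric.ball 0 1) := by
    have h2 : ContDiffOn ℝ 1 (fun x : ℂ => 4 / (1 - ‖x‖ ^ 2) ^ 2) (Metric.ball 0 1) := by
      refine contDiffOn_const.div ?_ fun x hx => ?_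
      · exact ((contDiff_const.sub (contDiff_norm_sq ℝ)).pow 2).contDiffOn
      · have : ‖x‖ < 1 := by simpa using hx
        have := norm_nonneg x
        exact pow_ne_zero _ (by nlinarith)
    have h3 : ContDiff ℝ 1 fun x : ℂ => innerSL ℝ (x + ‖x‖ • x) :=
      (innerSL ℝ (E := ℂ)).contDiff.comp (contDiff_id.add (contDiff_one_norm_smul_self ℂ))
    exact h2.smul h3.contDiffOn
  refine h1.congr fun x hx => ?_
  rw [(hd x hx).fderiv, map_add, map_smul]
  module

lemma magicPlus_eq_ratioEnergy {F : Mat 2} (hF : F ∈ GLPlus 2) :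
    magicPlus F = ratioEnergy ‖antiPart F / confPart F‖ + Real.log F.det := by
  have h := norm_antiPart_lt hF
  have h0 := (norm_nonneg _).trans_lt h
  rw [magicPlus, ratioEnergy, (sigma_eq hF).1, (sigma_eq hF).2, norm_div]
  have : (1 + ‖antiPart F‖ / ‖confPart F‖) / (1 - ‖antiPart F‖ / ‖confPart F‖)
      = (‖confPart F‖ + ‖antiPart F‖) / (‖confPart F‖ - ‖antiPart F‖) := by
    have := sub_pos.2 h
    have h2 : 1 - ‖antiPart F‖ / ‖confPart F‖ ≠ 0 := by
      rw [ne_eq, sub_eq_zero, eq_comm, div_eq_one_iff_eq h0.ne']; exact h.ne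
    field_simp
  rw [this]

open scoped Matrix.Norms.Frobenius in
theorem isC2_magicPlus : IsC2 magicPlus := by
  have ha : ContDiff ℝ 2 fun F : Mat 2 => confPart F := confPart.toContinuousLinearMap.contDiff
  have hb : ContDiff ℝ 2 fun F : Mat 2 => antiPart F := antiPart.toContinuousLinearMap.contDiff
  have ha0 : ∀ F ∈ GLPlus 2, confPart F ≠ 0 := fun F hF =>
    norm_pos_iff.1 ((norm_nonneg _).trans_lt (norm_antiPart_lt hF))
  have h1 : ContDiffOn ℝ 2 (fun F : Mat 2 => antiPart F / confPart F) (GLPlus 2) := by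
    simp only [div_eq_mul_inv]
    exact hb.contDiffOn.mul (ha.contDiffOn.inv ha0)
  have hdet : ContDiff ℝ 2 fun F : Mat 2 => F.det := by
    simp only [det_eq_norm_sq_sub]
    exact (ha.norm_sq ℝ).sub (hb.norm_sq ℝ)
  refine ContDiffOn.congr (f := fun F : Mat 2 => ratioEnergy ‖antiPart F / confPart F‖
    + Real.log F.det) ?_ fun F hF => magicPlus_eq_ratioEnergy hF
  refine (contDiffOn_ratioEnergy_norm.comp h1 fun F hF => ?_).add
    (hdet.contDiffOn.log fun F hF => (show 0 < F.det from hF).ne')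
  rw [mem_ball_zero_iff, norm_div, div_lt_one (norm_pos_iff.2 (ha0 F hF))]
  exact norm_antiPart_lt hF

theorem magicPlus_mem_MPlus : magicPlus ∈ MPlus := by
  -- Taking `max t t⁻¹` makes the isochoric part invariant under `t ↦ 1/t`.
  refine ⟨fun t => max t t⁻¹ - Real.log (max t t⁻¹), Real.log, ⟨fun t _ => ?_, fun F hF => ?_⟩, ?_⟩
  · simp [max_comm]
  · have h1 := one_le_sigmaMax_div hF
    beta_reduce
    rw [max_eq_left ((inv_le_one_of_one_le₀ h1).trans h1), sigmaMax_mul_sigmaMin hF, magicPlus]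
  · have h : ConvexOn ℝ (Ioi (1 : ℝ)) fun t => t - Real.log t :=
      (convexOn_id (convex_Ioi 1)).sub
        (strictConcaveOn_log_Ioi.concaveOn.subset (Ioi_subset_Ioi zero_le_one) (convex_Ioi 1))
    refine h.congr fun t ht => ?_
    have ht' : 1 ≤ t := (mem_Ioi.1 ht).le
    simp only [max_eq_left ((inv_le_one_of_one_le₀ ht').trans ht')]

end PlanarEnergy

/-! ### Null Lagrangians for Lipschitz functions -/

section LineDeriv

variable {E : Type*} [NormedAddCommGroup E] [NormedSpace ℝ E] [FiniteDimensional ℝ E]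
  [MeasurableSpace E] [BorelSpace E] {μ : Measure E} [μ.IsAddHaarMeasure]
  {C D : ℝ≥0} {u v : E → ℝ}

lemma LipschitzWith.integrable_lineDeriv (hu : LipschitzWith C u) (hu' : HasCompactSupport u)
    (w : E) : Integrable (fun x => lineDeriv ℝ u x w) μ := by
  have hs : Function.support (fun x => lineDeriv ℝ u x w) ⊆ tsupport u := by
    intro x hx
    by_contra hxu
    refine hx ?_
    have h0 : u =ᶠ[nhds x] fun _ => (0 : ℝ) := notMem_tsupport_iff_eventuallyEq.1 hxu
    simp only [h0.lineDeriv_eq]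
    simp [lineDeriv]
  rw [← integrableOn_iff_integrable_of_support_subset hs]
  exact (hu.locallyIntegrable_lineDeriv w).integrableOn_isCompact hu'

lemma LipschitzWith.integral_lineDeriv_eq_zero (hu : LipschitzWith C u)
    (hu' : HasCompactSupport u) (w : E) : ∫ x, lineDeriv ℝ u x w ∂μ = 0 := by
  have h := (LipschitzWith.const (1 : ℝ)).integral_lineDeriv_mul_eq (μ := μ) hu hu' (-w)
  simpa [lineDeriv] using h.symm

lemma LipschitzWith.integrable_lineDeriv_mul_lineDeriv (hu : LipschitzWith C u)
    (hv : LipschitzWith D v) (hu' : HasCompactSupport u) (w₁ w₂ : E) :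
    Integrable (fun x => lineDeriv ℝ u x w₁ * lineDeriv ℝ v x w₂) μ :=
  (hu.integrable_lineDeriv hu' w₁).mul_bdd (aestronglyMeasurable_lineDeriv hv.continuous μ)
    (.of_forall fun _ => norm_lineDeriv_le_of_lipschitz ℝ hv)

/-- The null Lagrangian property of `2 × 2` minors for Lipschitz functions. -/
lemma LipschitzWith.integral_lineDeriv_mul_lineDeriv_comm (hu : LipschitzWith C u)
    (hv : LipschitzWith D v) (hu' : HasCompactSupport u) (hv' : HasCompactSupport v) (w₁ w₂ : E) :
    ∫ x, lineDeriv ℝ u x w₁ * lineDeriv ℝ v x w₂ ∂μ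
      = ∫ x, lineDeriv ℝ u x w₂ * lineDeriv ℝ v x w₁ ∂μ := by
  set u₁ : E → ℝ := fun x => lineDeriv ℝ u x w₁
  set v₁ : E → ℝ := fun x => lineDeriv ℝ v x w₁
  have hu₁ : Integrable u₁ μ := hu.integrable_lineDeriv hu' w₁
  have hv₁ : Integrable v₁ μ := hv.integrable_lineDeriv hv' w₁
  -- Second derivatives need not exist, so the `w₂` derivative is replaced by difference quotients.
  -- Integration by parts in direction `w₁` and a translation then carry the quotient from `v` to
  -- `u`, before passing to the limit.
  have L := hv.integral_inv_smul_sub_mul_tendsto_integral_lineDeriv_mul hu₁ w₂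
  have R := hu.integral_inv_smul_sub_mul_tendsto_integral_lineDeriv_mul hv₁ (-w₂)
  have hparts : ∀ y : E, ∫ x, v (x + y) * u₁ x ∂μ = -∫ x, u (x + -y) * v₁ x ∂μ := by
    intro y
    have hvy : LipschitzWith D fun x => v (x + y) := by
      simpa [Function.comp_def] using hv.comp (isometry_add_right y).lipschitz
    have hvy' : HasCompactSupport fun x => v (x + y) :=
      hv'.comp_homeomorph (Homeomorph.addRight y)
    have h1 := hu.integral_lineDeriv_mul_eq (μ := μ) hvy hvy' w₁
    have h2 : ∀ x, lineDeriv ℝ (fun x => v (x + y)) x (-w₁) = -v₁ (x + y) := fun x => by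
      rw [lineDeriv_neg]
      simp only [lineDeriv, v₁, add_right_comm]
    simp only [h2, neg_mul, integral_neg] at h1
    have h3 := integral_add_right_eq_self (μ := μ) (fun x => u (x + -y) * v₁ x) y
    simp only [add_neg_cancel_right] at h3
    rw [← h3]
    simp only [mul_comm] at h1 ⊢
    exact h1
  have hbdd : ∀ {w : E → ℝ} {K : ℝ≥0}, LipschitzWith K w → HasCompactSupport w →
      ∀ {g : E → ℝ}, Integrable g μ → ∀ y, Integrable (fun x => w (x + y) * g x) μ := by
    intro w K hw hw' g hg y
    obtain ⟨c, hc⟩ := hw.continuous.bounded_above_of_compact_support hw'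
    exact hg.bdd_mul (c := c) (hw.continuous.comp (by fun_prop)).aestronglyMeasurable
      (.of_forall fun x => hc _)
  have hsub : ∀ {w : E → ℝ} {K : ℝ≥0}, LipschitzWith K w → HasCompactSupport w →
      ∀ {g : E → ℝ}, Integrable g μ → ∀ (t : ℝ) (y : E),
      ∫ x, (t⁻¹ • (w (x + y) - w x)) * g x ∂μ
        = t⁻¹ * (∫ x, w (x + y) * g x ∂μ - ∫ x, w x * g x ∂μ) := by
    intro w K hw hw' g hg t y
    have h0 := hbdd hw hw' hg 0
    simp only [add_zero] at h0
    rw [← integral_sub (hbdd hw hw' hg y) h0, ← integral_const_mul]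
    congr 1; ext x; simp only [smul_eq_mul]; ring
  have hLR : ∀ t : ℝ, ∫ x, (t⁻¹ • (v (x + t • w₂) - v x)) * u₁ x ∂μ
      = -∫ x, (t⁻¹ • (u (x + t • -w₂) - u x)) * v₁ x ∂μ := fun t => by
    rw [hsub hv hv' hu₁, hsub hu hu' hv₁, hparts, smul_neg]
    have := hparts 0
    simp only [neg_zero, add_zero] at this
    rw [this]; ring
  simp only [hLR] at L
  have h := tendsto_nhds_unique L R.neg
  simp only [lineDeriv_neg, neg_mul, integral_neg, neg_neg] at h
  rw [← h]
  simp only [u₁, mul_comm]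

end LineDeriv

/-! ### Integrals of the gradient and of its determinant -/

namespace PlanarEnergy

/-- The boundary of `Ω` may have positive measure. Still, `θ` is constant on the complement, and the
derivative at almost every point of a set is determined by the values on that set. -/
lemma ae_grad_eq_zero {n : ℕ} {Ω : Set (Fin n → ℝ)} (hΩ : IsOpen Ω)
    {θ : (Fin n → ℝ) → (Fin n → ℝ)} (hθ : IsW0OneInfty Ω θ) :
    ∀ᵐ x, x ∉ Ω → grad θ x = 0 := by
  obtain ⟨⟨L, hL⟩, h0⟩ := hθ
  set s : Set (Fin n → ℝ) := Ωᶜ ∩ {x | DifferentiableAt ℝ θ x}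
  have hs : MeasurableSet s := hΩ.measurableSet.compl.inter (measurableSet_of_differentiableAt ℝ θ)
  have happ : ApproximatesLinearOn θ (0 : (Fin n → ℝ) →L[ℝ] (Fin n → ℝ)) s 0 := fun x hx y hy => by
    simp [h0 x hx.1, h0 y hy.1]
  have h := happ.norm_fderiv_sub_le volume hs (fderiv ℝ θ)
    fun x hx => (hx.2 : DifferentiableAt ℝ θ x).hasFDerivAt.hasFDerivWithinAt
  rw [ae_restrict_iff' hs] at h
  filter_upwards [h, hL.ae_differentiableAt] with x hx hd hxΩ
  have : fderiv ℝ θ x = 0 := by simpa using hx ⟨hxΩ, hd⟩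
  simp [grad, this]

lemma ae_grad_apply {n : ℕ} {θ : (Fin n → ℝ) → (Fin n → ℝ)} {L : ℝ≥0} (hθ : LipschitzWith L θ) :
    ∀ᵐ x, ∀ i j, grad θ x i j = lineDeriv ℝ (fun y => θ y i) x (Pi.single j 1) := by
  filter_upwards [hθ.ae_differentiableAt] with x hx i j
  have hi : DifferentiableAt ℝ (fun y => θ y i) x := differentiableAt_pi.1 hx i
  rw [hi.lineDeriv_eq_fderiv, fderiv_apply hx]
  simp [grad, LinearMap.toMatrix'_apply, Pi.single]

section Bounded

variable {n : ℕ} {Ω : Set (Fin n → ℝ)} {θ : (Fin n → ℝ) → (Fin n → ℝ)}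

lemma IsW0OneInfty.hasCompactSupport_apply (hΩ : Bornology.IsBounded Ω) (hθ : IsW0OneInfty Ω θ)
    (i : Fin n) : HasCompactSupport fun y => θ y i :=
  HasCompactSupport.intro hΩ.isCompact_closure fun x hx => by
    simp [hθ.2 x fun h => hx (subset_closure h)]

lemma integrable_grad_apply (hΩ : Bornology.IsBounded Ω) (hθ : IsW0OneInfty Ω θ) (i j : Fin n) :
    Integrable fun x => grad θ x i j := by
  obtain ⟨L, hL⟩ := hθ.1
  have hi : LipschitzWith (1 * L) fun y => θ y i := (LipschitzWith.eval i).comp hL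
  refine (hi.integrable_lineDeriv (hθ.hasCompactSupport_apply hΩ i) (Pi.single j 1)).congr ?_
  filter_upwards [ae_grad_apply hL] with x hx using (hx i j).symm

lemma integral_grad_apply (hΩ : Bornology.IsBounded Ω) (hθ : IsW0OneInfty Ω θ) (i j : Fin n) :
    ∫ x, grad θ x i j = 0 := by
  obtain ⟨L, hL⟩ := hθ.1
  have hi : LipschitzWith (1 * L) fun y => θ y i := (LipschitzWith.eval i).comp hL
  rw [← hi.integral_lineDeriv_eq_zero (μ := volume) (hθ.hasCompactSupport_apply hΩ i)
    (Pi.single j 1)]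
  refine integral_congr_ae ?_
  filter_upwards [ae_grad_apply hL] with x hx using hx i j

lemma integrable_grad_mul_grad (hΩ : Bornology.IsBounded Ω) (hθ : IsW0OneInfty Ω θ)
    (i j k l : Fin n) : Integrable fun x => grad θ x i j * grad θ x k l := by
  obtain ⟨L, hL⟩ := hθ.1
  have hi : ∀ i, LipschitzWith (1 * L) fun y => θ y i := fun i => (LipschitzWith.eval i).comp hL
  refine ((hi i).integrable_lineDeriv_mul_lineDeriv (hi k) (hθ.hasCompactSupport_apply hΩ i)
    (Pi.single j 1) (Pi.single l 1)).congr ?_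
  filter_upwards [ae_grad_apply hL] with x hx
  rw [hx, hx]

lemma integral_grad_mul_grad (hΩ : Bornology.IsBounded Ω) (hθ : IsW0OneInfty Ω θ)
    (i j k l : Fin n) :
    ∫ x, grad θ x i j * grad θ x k l = ∫ x, grad θ x i l * grad θ x k j := by
  obtain ⟨L, hL⟩ := hθ.1
  have hi : ∀ i, LipschitzWith (1 * L) fun y => θ y i := fun i => (LipschitzWith.eval i).comp hL
  have h := (hi i).integral_lineDeriv_mul_lineDeriv_comm (μ := volume) (hi k)
    (hθ.hasCompactSupport_apply hΩ i) (hθ.hasCompactSupport_apply hΩ k)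
    (Pi.single j 1) (Pi.single l 1)
  have h' : ∀ i j k l, ∫ x, grad θ x i j * grad θ x k l
      = ∫ x, lineDeriv ℝ (fun y => θ y i) x (Pi.single j 1)
        * lineDeriv ℝ (fun y => θ y k) x (Pi.single l 1) := fun i j k l => by
    refine integral_congr_ae ?_
    filter_upwards [ae_grad_apply hL] with x hx
    rw [hx, hx]
  rw [h', h', h]

end Bounded

lemma apply_eq_sum_single (S : Mat 2 →ₗ[ℝ] ℝ) (X : Mat 2) :
    S X = ∑ i, ∑ j, S (Matrix.single i j 1) * X i j := by
  conv_lhs => rw [Matrix.matrix_eq_sum_single X]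
  simp only [map_sum]
  refine Finset.sum_congr rfl fun i _ => Finset.sum_congr rfl fun j _ => ?_
  rw [show Matrix.single i j (X i j) = X i j • Matrix.single i j (1 : ℝ) by simp, map_smul,
    smul_eq_mul, mul_comm]

/-- The linear part of `X ↦ det (F + X)`. -/
noncomputable def detLinear (F : Mat 2) : Mat 2 →ₗ[ℝ] ℝ where
  toFun X := F 0 0 * X 1 1 + F 1 1 * X 0 0 - F 0 1 * X 1 0 - F 1 0 * X 0 1
  map_add' X Y := by simp; ring
  map_smul' c X := by simp; ring

lemma det_add_eq (F X : Mat 2) : (F + X).det = F.det + detLinear F X + X.det := by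
  simp [Matrix.det_fin_two, detLinear]; ring

variable {Ω : Set (Fin 2 → ℝ)} {θ : (Fin 2 → ℝ) → (Fin 2 → ℝ)}

lemma integrable_linear_grad (hΩ : Bornology.IsBounded Ω) (hθ : IsW0OneInfty Ω θ)
    (S : Mat 2 →ₗ[ℝ] ℝ) : Integrable fun x => S (grad θ x) := by
  simp only [apply_eq_sum_single S (grad θ _)]
  exact integrable_finsetSum _ fun i _ => integrable_finsetSum _ fun j _ =>
    (integrable_grad_apply hΩ hθ i j).const_mul _

lemma integral_linear_grad (hΩ : Bornology.IsBounded Ω) (hθ : IsW0OneInfty Ω θ)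
    (S : Mat 2 →ₗ[ℝ] ℝ) : ∫ x, S (grad θ x) = 0 := by
  simp only [apply_eq_sum_single S (grad θ _)]
  rw [integral_finsetSum _ fun i _ => integrable_finsetSum _ fun j _ =>
    (integrable_grad_apply hΩ hθ i j).const_mul _]
  refine Finset.sum_eq_zero fun i _ => ?_
  rw [integral_finsetSum _ fun j _ => (integrable_grad_apply hΩ hθ i j).const_mul _]
  refine Finset.sum_eq_zero fun j _ => ?_
  rw [integral_const_mul, integral_grad_apply hΩ hθ, mul_zero]

lemma integrable_det_grad (hΩ : Bornology.IsBounded Ω) (hθ : IsW0OneInfty Ω θ) :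
    Integrable fun x => (grad θ x).det := by
  simp only [Matrix.det_fin_two]
  exact (integrable_grad_mul_grad hΩ hθ _ _ _ _).sub (integrable_grad_mul_grad hΩ hθ _ _ _ _)

lemma integral_det_grad (hΩ : Bornology.IsBounded Ω) (hθ : IsW0OneInfty Ω θ) :
    ∫ x, (grad θ x).det = 0 := by
  simp only [Matrix.det_fin_two]
  rw [integral_sub (integrable_grad_mul_grad hΩ hθ _ _ _ _)
    (integrable_grad_mul_grad hΩ hθ _ _ _ _), integral_grad_mul_grad hΩ hθ, sub_self]

lemma integrableOn_affine (hΩ : Bornology.IsBounded Ω) (hθ : IsW0OneInfty Ω θ) (F : Mat 2)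
    (S : Mat 2 →ₗ[ℝ] ℝ) (r s : ℝ) :
    IntegrableOn (fun x => r + S (grad θ x) + s * ((F + grad θ x).det - F.det)) Ω := by
  have h : Integrable fun x => (S + s • detLinear F) (grad θ x) + s * (grad θ x).det :=
    (integrable_linear_grad hΩ hθ _).add ((integrable_det_grad hΩ hθ).const_mul s)
  have hr : IntegrableOn (fun _ => r) Ω := integrableOn_const hΩ.measure_lt_top.ne
  refine (Integrable.add hr h.integrableOn).congr (.of_forall fun x => ?_)
  simp only [Pi.add_apply, det_add_eq, LinearMap.add_apply, LinearMap.smul_apply, smul_eq_mul]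
  ring

/-- Expanding `det (F + ∇θ)` leaves a linear term and `det ∇θ`, both with zero integral over the
plane and vanishing almost everywhere off `Ω`. -/
lemma setIntegral_affine (hΩ : IsOpen Ω) (hΩb : Bornology.IsBounded Ω) (hθ : IsW0OneInfty Ω θ)
    (F : Mat 2) (S : Mat 2 →ₗ[ℝ] ℝ) (r s : ℝ) :
    ∫ x in Ω, (r + S (grad θ x) + s * ((F + grad θ x).det - F.det)) = volume.real Ω * r := by
  have h1 := integrable_linear_grad hΩb hθ (S + s • detLinear F)
  have h2 := (integrable_det_grad hΩb hθ).const_mul s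
  have hr : IntegrableOn (fun _ => r) Ω := integrableOn_const hΩb.measure_lt_top.ne
  have h0 : ∫ x in Ω, ((S + s • detLinear F) (grad θ x) + s * (grad θ x).det) = 0 := by
    rw [setIntegral_eq_integral_of_ae_compl_eq_zero, integral_add h1 h2,
      integral_linear_grad hΩb hθ, integral_const_mul, integral_det_grad hΩb hθ, mul_zero, add_zero]
    filter_upwards [ae_grad_eq_zero hΩ hθ] with x hx hxΩ
    simp [hx hxΩ]
  calc _ = ∫ x in Ω, (r + ((S + s • detLinear F) (grad θ x) + s * (grad θ x).det)) := by
        congr 1; ext x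
        simp only [det_add_eq, LinearMap.add_apply, LinearMap.smul_apply, smul_eq_mul]
        ring
    _ = _ := by
        have h12 : IntegrableOn (fun x => (S + s • detLinear F) (grad θ x)
            + s * (grad θ x).det) Ω := (h1.add h2).integrableOn
        rw [integral_add hr h12, h0, setIntegral_const, smul_eq_mul, add_zero]

/-! ### Extended integrals and admissible perturbations -/

section ExtIntegral

variable {n : ℕ} {Ω : Set (Fin n → ℝ)} {g : (Fin n → ℝ) → EReal} {q : (Fin n → ℝ) → ℝ}

lemma extIntegral_of_lintegral_eq_top (h : ∫⁻ x in Ω, (g x).toENNReal = ⊤) :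
    extIntegral Ω g = ⊤ := by
  rw [extIntegral, if_pos h]

lemma coe_lintegral_sub_lintegral_neg (hq : IntegrableOn q Ω) :
    ((∫⁻ x in Ω, ENNReal.ofReal (q x) : ℝ≥0∞) : EReal)
      - ((∫⁻ x in Ω, ENNReal.ofReal (-q x) : ℝ≥0∞) : EReal) = ((∫ x in Ω, q x : ℝ) : EReal) := by
  have h1 : ∫⁻ x in Ω, ENNReal.ofReal (q x) ≠ ⊤ := hq.lintegral_lt_top.ne
  have h2 : ∫⁻ x in Ω, ENNReal.ofReal (-q x) ≠ ⊤ := hq.neg.lintegral_lt_top.ne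
  rw [integral_eq_lintegral_pos_part_sub_lintegral_neg_part hq, EReal.coe_sub,
    EReal.coe_ennreal_toReal h1, EReal.coe_ennreal_toReal h2]

lemma toENNReal_neg_coe (r : ℝ) : (-(r : EReal)).toENNReal = ENNReal.ofReal (-r) := by
  rw [← EReal.coe_neg, EReal.toENNReal_of_ne_top (EReal.coe_ne_top _), EReal.toReal_coe]

lemma toENNReal_coe (r : ℝ) : (r : EReal).toENNReal = ENNReal.ofReal r := by
  rw [EReal.toENNReal_of_ne_top (EReal.coe_ne_top _), EReal.toReal_coe]

lemma le_extIntegral (hq : IntegrableOn q Ω) (h : ∀ᵐ x ∂volume.restrict Ω, (q x : EReal) ≤ g x) :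
    ((∫ x in Ω, q x : ℝ) : EReal) ≤ extIntegral Ω g := by
  unfold extIntegral
  split_ifs
  · exact le_top
  · rw [← coe_lintegral_sub_lintegral_neg hq]
    refine EReal.sub_le_sub ?_ ?_
    · refine EReal.coe_ennreal_le_coe_ennreal_iff.2 (lintegral_mono_ae ?_)
      filter_upwards [h] with x hx
      rw [← toENNReal_coe]
      exact EReal.toENNReal_le_toENNReal hx
    · refine EReal.coe_ennreal_le_coe_ennreal_iff.2 (lintegral_mono_ae ?_)
      filter_upwards [h] with x hx
      rw [← toENNReal_neg_coe]
      exact EReal.toENNReal_le_toENNReal (EReal.neg_le_neg_iff.2 hx)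

lemma coe_measure_mul_coe (hΩ : Bornology.IsBounded Ω) (r : ℝ) :
    ((volume Ω : ℝ≥0∞) : EReal) * (r : EReal) = ((volume.real Ω * r : ℝ) : EReal) := by
  rw [EReal.coe_mul, Measure.real, EReal.coe_ennreal_toReal hΩ.measure_lt_top.ne]

/-- A real lower bound on the extended integral of `q`, together with integrability of the positive
part, forces `q` to be integrable. -/
lemma integrableOn_of_le_extIntegral (hm : AEStronglyMeasurable q (volume.restrict Ω))
    (hg : ∀ᵐ x ∂volume.restrict Ω, g x = q x) (hpos : ∫⁻ x in Ω, ENNReal.ofReal (q x) ≠ ⊤)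
    {r : ℝ} (hr : (r : EReal) ≤ extIntegral Ω g) :
    IntegrableOn q Ω ∧ r ≤ ∫ x in Ω, q x := by
  have e1 : ∫⁻ x in Ω, (g x).toENNReal = ∫⁻ x in Ω, ENNReal.ofReal (q x) := by
    refine lintegral_congr_ae ?_
    filter_upwards [hg] with x hx
    rw [hx, toENNReal_coe]
  have e2 : ∫⁻ x in Ω, (-g x).toENNReal = ∫⁻ x in Ω, ENNReal.ofReal (-q x) := by
    refine lintegral_congr_ae ?_
    filter_upwards [hg] with x hx
    rw [hx, toENNReal_neg_coe]
  rw [extIntegral, e1, e2, if_neg hpos] at hr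
  -- An infinite negative part would make the extended integral `⊥`, below every real number.
  have hneg : ∫⁻ x in Ω, ENNReal.ofReal (-q x) ≠ ⊤ := by
    intro h
    rw [h, EReal.coe_ennreal_top, EReal.sub_top, le_bot_iff] at hr
    exact EReal.coe_ne_bot _ hr
  have hq : IntegrableOn q Ω := by
    refine ⟨hm, ?_⟩
    rw [hasFiniteIntegral_iff_norm]
    calc ∫⁻ x in Ω, ENNReal.ofReal ‖q x‖
        = ∫⁻ x in Ω, (ENNReal.ofReal (q x) + ENNReal.ofReal (-q x)) := by
          refine lintegral_congr fun x => ?_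
          rcases le_total 0 (q x) with h | h
          · rw [Real.norm_of_nonneg h, ENNReal.ofReal_of_nonpos (neg_nonpos.2 h), add_zero]
          · rw [Real.norm_of_nonpos h, ENNReal.ofReal_of_nonpos h, zero_add]
      _ = _ := lintegral_add_left' hm.aemeasurable.ennreal_ofReal _
      _ < ⊤ := ENNReal.add_lt_top.2 ⟨hpos.lt_top, hneg.lt_top⟩
  refine ⟨hq, ?_⟩
  rw [coe_lintegral_sub_lintegral_neg hq] at hr
  exact EReal.coe_le_coe_iff.1 hr

end ExtIntegral

lemma measurable_grad_apply {n : ℕ} (θ : (Fin n → ℝ) → (Fin n → ℝ)) (i j : Fin n) :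
    Measurable fun x => grad θ x i j := by
  have h := (measurable_pi_apply i).comp (measurable_fderiv_apply_const ℝ θ (Pi.single j 1))
  convert! h using 2 with x

variable {Ω : Set (Fin 2 → ℝ)} {θ : (Fin 2 → ℝ) → (Fin 2 → ℝ)}

lemma measurable_det_add_grad (F : Mat 2) (θ : (Fin 2 → ℝ) → (Fin 2 → ℝ)) :
    Measurable fun x => (F + grad θ x).det := by
  have h := fun i j => measurable_grad_apply θ i j
  simp only [Matrix.det_fin_two, Matrix.add_apply]
  fun_prop

lemma measurable_norm_confPart_add_grad (F : Mat 2) (θ : (Fin 2 → ℝ) → (Fin 2 → ℝ)) :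
    Measurable fun x => ‖confPart (F + grad θ x)‖ := by
  have h := fun i j => measurable_grad_apply θ i j
  have e : ∀ x, ‖confPart (F + grad θ x)‖ = √(‖confPart (F + grad θ x)‖ ^ 2) := fun x =>
    (Real.sqrt_sq (norm_nonneg _)).symm
  rw [funext e]
  simp only [norm_confPart_sq, Matrix.add_apply]
  fun_prop

lemma measurable_norm_antiPart_add_grad (F : Mat 2) (θ : (Fin 2 → ℝ) → (Fin 2 → ℝ)) :
    Measurable fun x => ‖antiPart (F + grad θ x)‖ := by
  have h := fun i j => measurable_grad_apply θ i j
  have e : ∀ x, ‖antiPart (F + grad θ x)‖ = √(‖antiPart (F + grad θ x)‖ ^ 2) := fun x =>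
    (Real.sqrt_sq (norm_nonneg _)).symm
  rw [funext e]
  simp only [norm_antiPart_sq, Matrix.add_apply]
  fun_prop

lemma aestronglyMeasurable_magicPlus {F : Mat 2}
    (h : ∀ᵐ x ∂volume.restrict Ω, F + grad θ x ∈ GLPlus 2) :
    AEStronglyMeasurable (fun x => magicPlus (F + grad θ x)) (volume.restrict Ω) := by
  have ha := measurable_norm_confPart_add_grad F θ
  have hb := measurable_norm_antiPart_add_grad F θ
  have hm : Measurable fun x => 2 * (‖confPart (F + grad θ x)‖
      / (‖confPart (F + grad θ x)‖ - ‖antiPart (F + grad θ x)‖)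
      + Real.log (‖confPart (F + grad θ x)‖ - ‖antiPart (F + grad θ x)‖)) - 1 :=
    (((ha.div (ha.sub hb)).add (ha.sub hb).log).const_mul 2).sub_const 1
  refine hm.aestronglyMeasurable.congr ?_
  filter_upwards [h] with x hx using (magicPlus_eq hx).symm

lemma extIntegral_extendTop_eq_top (W : Mat 2 → ℝ) {F : Mat 2}
    (h : ¬ ∀ᵐ x ∂volume.restrict Ω, F + grad θ x ∈ GLPlus 2) :
    extIntegral Ω (fun x => extendTop W (F + grad θ x)) = ⊤ := by
  refine extIntegral_of_lintegral_eq_top ?_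
  set Z : Set (Fin 2 → ℝ) := {x | ¬ F + grad θ x ∈ GLPlus 2} with hZ
  have hZm : MeasurableSet Z :=
    (measurableSet_lt measurable_const (measurable_det_add_grad F θ)).compl
  have hZ0 : volume.restrict Ω Z ≠ 0 := fun h0 => h (ae_iff.2 h0)
  rw [eq_top_iff]
  calc ⊤ = ∫⁻ _ in Z, ⊤ ∂volume.restrict Ω := by
        rw [setLIntegral_const, ENNReal.top_mul hZ0]
    _ ≤ ∫⁻ x in Z, (extendTop W (F + grad θ x)).toENNReal ∂volume.restrict Ω := by
        refine setLIntegral_mono_ae' hZm (.of_forall fun x hx => ?_)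
        have : ¬ F + grad θ x ∈ GLPlus 2 := hx
        simp [extendTop, this]
    _ ≤ _ := setLIntegral_le_lintegral _ _

/-- The mean of `det (F + ∇θ)` over `Ω` is `det F`. Consequently, for `F` outside `GLPlus` the
perturbed energy has integral `⊤` as well. -/
lemma mem_GLPlus_of_ae (hΩ : IsOpen Ω) (hΩn : Ω.Nonempty) (hΩb : Bornology.IsBounded Ω)
    (hθ : IsW0OneInfty Ω θ) {F : Mat 2}
    (h : ∀ᵐ x ∂volume.restrict Ω, F + grad θ x ∈ GLPlus 2) : F ∈ GLPlus 2 := by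
  have hvol : 0 < volume Ω := hΩ.measure_pos volume hΩn
  have h1 := integrableOn_affine hΩb hθ F 0 F.det 1
  have h2 := setIntegral_affine hΩ hΩb hθ F 0 F.det 1
  simp only [LinearMap.zero_apply, add_zero, one_mul, add_sub_cancel] at h1 h2
  have h3 : 0 < ∫ x in Ω, (F + grad θ x).det := by
    rw [integral_pos_iff_support_of_nonneg_ae (by filter_upwards [h] with x hx using le_of_lt hx) h1]
    refine hvol.trans_le ?_
    rw [← Measure.restrict_apply_univ]
    refine measure_mono_ae ?_
    filter_upwards [h] with x hx _ using (ne_of_gt hx : (F + grad θ x).det ≠ 0)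
  rw [h2] at h3
  exact pos_of_mul_pos_right h3 measureReal_nonneg

/-! ### Quasiconvexity from polyaffine supports -/

/-- Existence of supporting functions that are affine in `(F, det F)`, at every point of
`GL⁺(2)`. -/
def HasPolyaffineSupport (P : Mat 2 → ℝ) : Prop :=
  ∀ F ∈ GLPlus 2, ∃ (S : Mat 2 →ₗ[ℝ] ℝ) (s : ℝ), ∀ X, F + X ∈ GLPlus 2 →
    P F + S X + s * ((F + X).det - F.det) ≤ P (F + X)

/-- The support `L` of `P` at `F` integrates to `|Ω| P(F)`, so the bound follows by integrating `W ≥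
c · magicPlus + L`. Extended integrals are not additive in general; the work lies in showing that
`magicPlus` is integrable along the perturbation unless the integral of `W` is `⊤`. -/
theorem Quasiconvex.of_magicPlus {W P : Mat 2 → ℝ} {c : ℝ} (hc : 0 ≤ c)
    (hP : HasPolyaffineSupport P) (hW : ∀ F ∈ GLPlus 2, W F = c * magicPlus F + P F)
    (hmagic : Quasiconvex magicPlus) : Quasiconvex W := by
  intro Ω hΩ hΩc hΩb F θ hθ
  by_cases hae : ∀ᵐ x ∂volume.restrict Ω, F + grad θ x ∈ GLPlus 2
  swap
  · rw [extIntegral_extendTop_eq_top W hae]; exact le_top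
  have hF := mem_GLPlus_of_ae hΩ hΩc.nonempty hΩb hθ hae
  obtain ⟨S, s, hS⟩ := hP F hF
  set L : (Fin 2 → ℝ) → ℝ := fun x => P F + S (grad θ x) + s * ((F + grad θ x).det - F.det)
  have hL : IntegrableOn L Ω := integrableOn_affine hΩb hθ F S (P F) s
  have hLint : ∫ x in Ω, L x = volume.real Ω * P F := setIntegral_affine hΩ hΩb hθ F S (P F) s
  set q : (Fin 2 → ℝ) → ℝ := fun x => magicPlus (F + grad θ x)
  have hle : ∀ᵐ x ∂volume.restrict Ω, c * q x + L x ≤ W (F + grad θ x) := by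
    filter_upwards [hae] with x hx
    rw [hW _ hx]
    exact add_le_add le_rfl (hS _ hx)
  have hWx : ∀ᵐ x ∂volume.restrict Ω,
      extendTop W (F + grad θ x) = (W (F + grad θ x) : EReal) := by
    filter_upwards [hae] with x hx
    simp [extendTop, hx]
  have hleE : ∀ᵐ x ∂volume.restrict Ω,
      ((c * q x + L x : ℝ) : EReal) ≤ extendTop W (F + grad θ x) := by
    filter_upwards [hle, hWx] with x hx hx'
    rw [hx']
    exact EReal.coe_le_coe_iff.2 hx
  have hWF : extendTop W F = ((c * magicPlus F + P F : ℝ) : EReal) := by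
    rw [← hW F hF]; simp [extendTop, hF]
  rw [hWF, coe_measure_mul_coe hΩb]
  -- For `c = 0` nothing controls the integrability of the magic term, so `L` alone serves as lower
  -- bound.
  rcases hc.eq_or_lt with rfl | hc
  · simp only [zero_mul, zero_add] at hleE ⊢
    rw [← hLint]
    exact le_extIntegral hL hleE
  by_cases htop : ∫⁻ x in Ω, (extendTop W (F + grad θ x)).toENNReal = ⊤
  · rw [extIntegral_of_lintegral_eq_top htop]; exact le_top
  -- The positive part of the magic term is at most `c⁻¹ (W⁺ + L⁻)`.
  have hpos : ∫⁻ x in Ω, ENNReal.ofReal (q x) ≠ ⊤ := by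
    refine ne_top_of_le_ne_top (b := ∫⁻ x in Ω, ENNReal.ofReal c⁻¹ *
      ((extendTop W (F + grad θ x)).toENNReal + ENNReal.ofReal (-L x))) ?_ ?_
    · rw [lintegral_const_mul' _ _ ENNReal.ofReal_ne_top]
      refine ENNReal.mul_ne_top ENNReal.ofReal_ne_top ?_
      have hLm : AEMeasurable (fun x => ENNReal.ofReal (-L x)) (volume.restrict Ω) :=
        hL.aestronglyMeasurable.aemeasurable.neg.ennreal_ofReal
      rw [lintegral_add_right' _ hLm]
      exact ENNReal.add_ne_top.2 ⟨htop, hL.neg.lintegral_lt_top.ne⟩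
    · refine lintegral_mono_ae ?_
      filter_upwards [hle, hWx] with x hx hx'
      rw [hx', toENNReal_coe]
      calc ENNReal.ofReal (q x) ≤ ENNReal.ofReal (c⁻¹ * (W (F + grad θ x) + -L x)) := by
            refine ENNReal.ofReal_le_ofReal ?_
            rw [le_inv_mul_iff₀ hc]
            linarith
        _ = ENNReal.ofReal c⁻¹ * ENNReal.ofReal (W (F + grad θ x) + -L x) :=
            ENNReal.ofReal_mul (inv_nonneg.2 hc.le)
        _ ≤ _ := by gcongr; exact ENNReal.ofReal_add_le
  have hmag : ((volume.real Ω * magicPlus F : ℝ) : EReal)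
      ≤ extIntegral Ω (fun x => extendTop magicPlus (F + grad θ x)) := by
    have := hmagic Ω hΩ hΩc hΩb F θ hθ
    rwa [show extendTop magicPlus F = (magicPlus F : EReal) by simp [extendTop, hF],
      coe_measure_mul_coe hΩb] at this
  obtain ⟨hq, hqint⟩ := integrableOn_of_le_extIntegral (q := q)
    (aestronglyMeasurable_magicPlus hae)
    (by filter_upwards [hae] with x hx; simp [extendTop, hx, q]) hpos hmag
  have hqc : IntegrableOn (fun x => c * q x) Ω := hq.const_mul c
  refine le_trans ?_ (le_extIntegral (hqc.add hL) hleE)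
  refine EReal.coe_le_coe_iff.2 ?_
  have : ∫ x in Ω, ((fun x => c * q x) + L) x = c * (∫ x in Ω, q x) + volume.real Ω * P F := by
    rw [integral_add' hqc hL, integral_const_mul, hLint]
  rw [this]
  nlinarith

end PlanarEnergy

/-! ### Tangents and polyaffine supports -/

lemma ConvexOn.nonneg_of_hasDerivAt_hasDerivAt {s : Set ℝ} (hs : IsOpen s) {φ φ' : ℝ → ℝ}
    (hφ : ConvexOn ℝ s φ) (h : ∀ x ∈ s, HasDerivAt φ (φ' x) x) {x d : ℝ} (hx : x ∈ s)
    (hd : HasDerivAt φ' d x) : 0 ≤ d := by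
  have hm : MonotoneOn φ' s :=
    (hφ.monotoneOn_deriv fun y hy => (h y hy).differentiableAt).congr fun y hy => (h y hy).deriv
  rw [← hd.hasDerivWithinAt.derivWithin (hs.uniqueDiffWithinAt hx)]
  exact hm.derivWithin_nonneg

lemma ConvexOn.add_mul_sub_le {s : Set ℝ} {φ : ℝ → ℝ} (hφ : ConvexOn ℝ s φ) {x y d : ℝ}
    (hx : x ∈ s) (hy : y ∈ s) (hd : HasDerivAt φ d x) : φ x + d * (y - x) ≤ φ y := by
  rcases lt_trichotomy x y with h | rfl | h
  · have := hφ.le_slope_of_hasDerivAt hx hy h hd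
    rw [slope_def_field, le_div_iff₀ (sub_pos.2 h)] at this
    linarith
  · simp
  · have := hφ.slope_le_of_hasDerivAt hy hx h hd
    rw [slope_def_field, div_le_iff₀ (sub_pos.2 h)] at this
    linarith

lemma ContDiffOn.hasDerivAt_deriv_deriv {s : Set ℝ} (hs : IsOpen s) {φ : ℝ → ℝ}
    (h : ContDiffOn ℝ 2 φ s) {x : ℝ} (hx : x ∈ s) :
    HasDerivAt φ (deriv φ x) x ∧ HasDerivAt (deriv φ) (deriv (deriv φ) x) x := by
  have h1 : ContDiffOn ℝ 1 (deriv φ) s := h.deriv_of_isOpen hs (by norm_num)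
  exact ⟨((h.differentiableOn (by norm_num)).differentiableAt (hs.mem_nhds hx)).hasDerivAt,
    ((h1.differentiableOn (by norm_num)).differentiableAt (hs.mem_nhds hx)).hasDerivAt⟩

/-- A norming functional from Hahn–Banach is a subgradient of the norm. -/
lemma exists_norm_add_le_norm_add (z : ℂ) : ∃ l : ℂ →ₗ[ℝ] ℝ, ∀ w, ‖z‖ + l w ≤ ‖z + w‖ := by
  obtain ⟨l, hl, hz⟩ := exists_dual_vector'' ℝ z
  refine ⟨l.toLinearMap, fun w => ?_⟩
  have h : l (z + w) ≤ ‖z + w‖ :=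
    (le_abs_self _).trans ((l.le_of_opNorm_le hl _).trans_eq (one_mul _))
  rw [map_add, hz] at h
  simpa using h

namespace PlanarEnergy

/-- On `GLPlus 2` one has `K = σmax² / det`, where `σmax = |a| + |b|` is convex and `x² / y` is
jointly convex for `y > 0` and increasing in `x > 0`. The tangent plane of `x² / y` composed with
subgradients supports `K`; a slope `m ≥ 0` carries this support over to `G(K)`. -/
lemma hasPolyaffineSupport_of_tangents {G g : ℝ → ℝ}
    (hG : ∀ t₀, 1 ≤ t₀ → ∃ m, 0 ≤ m ∧ ∀ t, 1 ≤ t → G t₀ + m * (t - t₀) ≤ G t)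
    (hg : ∀ z₀, 0 < z₀ → ∃ m, ∀ z, 0 < z → g z₀ + m * (z - z₀) ≤ g z) :
    HasPolyaffineSupport fun F => G (sigmaMax F / sigmaMin F) + g F.det := by
  intro F hF
  have hd : 0 < F.det := hF
  obtain ⟨la, hla⟩ := exists_norm_add_le_norm_add (confPart F)
  obtain ⟨lb, hlb⟩ := exists_norm_add_le_norm_add (antiPart F)
  obtain ⟨m, hm0, hm⟩ := hG _ (one_le_sigmaMax_div hF)
  obtain ⟨k, hk⟩ := hg _ hd
  refine ⟨(m * (2 * sigmaMax F / F.det)) • (la ∘ₗ confPart + lb ∘ₗ antiPart),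
    k - m * (sigmaMax F ^ 2 / F.det ^ 2), fun X hX => ?_⟩
  have hd' : 0 < (F + X).det := hX
  have h1 := hm _ (one_le_sigmaMax_div hX)
  have h2 := hk _ hd'
  have hσ0 : 0 < sigmaMax F := (sigmaMin_pos hF).trans_le (sigmaMin_le_sigmaMax F)
  have hσ : sigmaMax F + (la (confPart X) + lb (antiPart X)) ≤ sigmaMax (F + X) := by
    rw [(sigma_eq hF).1, (sigma_eq hX).1, map_add, map_add]
    linarith [hla (confPart X), hlb (antiPart X)]
  -- The two sides differ by `(x - x₀ y / y₀)² / y`, with `x` for `σmax` and `y` for `det`.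
  have hK : sigmaMax F ^ 2 / F.det + 2 * sigmaMax F / F.det * (sigmaMax (F + X) - sigmaMax F)
      - sigmaMax F ^ 2 / F.det ^ 2 * ((F + X).det - F.det)
      ≤ sigmaMax (F + X) ^ 2 / (F + X).det := by
    have : 0 ≤ (sigmaMax (F + X) - sigmaMax F * (F + X).det / F.det) ^ 2 / (F + X).det := by
      positivity
    rw [← sub_nonneg]
    convert! this using 1
    field_simp
    ring
  have hslope : 2 * sigmaMax F / F.det * (la (confPart X) + lb (antiPart X))
      ≤ 2 * sigmaMax F / F.det * (sigmaMax (F + X) - sigmaMax F) :=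
    mul_le_mul_of_nonneg_left (by linarith) (by positivity)
  rw [sigmaMax_div_sigmaMin hF, sigmaMax_div_sigmaMin hX] at h1
  have h3 : 2 * sigmaMax F / F.det * (la (confPart X) + lb (antiPart X))
      - sigmaMax F ^ 2 / F.det ^ 2 * ((F + X).det - F.det)
      ≤ sigmaMax (F + X) ^ 2 / (F + X).det - sigmaMax F ^ 2 / F.det := by linarith
  have h4 := mul_le_mul_of_nonneg_left h3 hm0
  simp only [sigmaMax_div_sigmaMin hF, sigmaMax_div_sigmaMin hX, LinearMap.smul_apply,
    LinearMap.add_apply, LinearMap.comp_apply, smul_eq_mul]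
  linarith

/-! ### Diagonal restrictions and the decomposition of the energy -/

/-- The diagonal matrix with entries `s` and `b`. -/
noncomputable def diagMat (s b : ℝ) : Mat 2 :=
  s • Matrix.single 0 0 1 + b • Matrix.single 1 1 1

lemma det_diagMat (s b : ℝ) : (diagMat s b).det = s * b := by
  simp [diagMat, Matrix.det_fin_two, Matrix.single]

lemma IsVolIsoSplit.apply_diagMat {W : Mat 2 → ℝ} {h f : ℝ → ℝ} (hW : IsVolIsoSplit W h f)
    {s b : ℝ} (hs : 0 < s) (hb : 0 < b) : W (diagMat s b) = h (s / b) + f (s * b) := by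
  have hG : diagMat s b ∈ GLPlus 2 := by
    change 0 < (diagMat s b).det
    rw [det_diagMat]; positivity
  have ha : ‖confPart (diagMat s b)‖ = (s + b) / 2 := by
    rw [← Real.sqrt_sq (norm_nonneg (confPart _)), norm_confPart_sq]
    rw [← Real.sqrt_sq (show 0 ≤ (s + b) / 2 by positivity)]
    congr 1
    simp [diagMat, Matrix.single]; ring
  have hb' : ‖antiPart (diagMat s b)‖ = |s - b| / 2 := by
    rw [← Real.sqrt_sq (norm_nonneg (antiPart _)), norm_antiPart_sq,
      ← Real.sqrt_sq (show 0 ≤ |s - b| / 2 by positivity), div_pow, sq_abs]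
    congr 1
    simp [diagMat, Matrix.single]; ring
  rw [hW.2 _ hG, sigmaMax_mul_sigmaMin hG, det_diagMat, (sigma_eq hG).1, (sigma_eq hG).2, ha, hb']
  congr 1
  rcases le_total b s with hle | hle
  · rw [abs_of_nonneg (sub_nonneg.2 hle)]
    congr 1; congr 1 <;> ring
  · rw [abs_of_nonpos (sub_nonpos.2 hle), hW.1 (s / b) (by positivity), one_div_div]
    congr 1; congr 1 <;> ring

section Split

variable {W : Mat 2 → ℝ} {h f : ℝ → ℝ}

open scoped Matrix.Norms.Frobenius in
lemma IsC2.comp_diagMat (hC : IsC2 W) {u v : ℝ → ℝ} (hu : ContDiffOn ℝ 2 u (Ioi 0))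
    (hv : ContDiffOn ℝ 2 v (Ioi 0)) (hu0 : ∀ t ∈ Ioi (0 : ℝ), 0 < u t)
    (hv0 : ∀ t ∈ Ioi (0 : ℝ), 0 < v t) :
    ContDiffOn ℝ 2 (fun t => W (diagMat (u t) (v t))) (Ioi 0) := by
  have h1 : ContDiffOn ℝ 2 (fun t => diagMat (u t) (v t)) (Ioi 0) := by
    unfold diagMat
    exact (hu.smul contDiffOn_const).add (hv.smul contDiffOn_const)
  refine ContDiffOn.comp (hC : ContDiffOn ℝ 2 W (GLPlus 2)) h1 fun t ht => ?_
  change 0 < (diagMat (u t) (v t)).det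
  rw [det_diagMat]
  exact mul_pos (hu0 t ht) (hv0 t ht)

/-- On the multiples `√t · 1` of the identity the isochoric part is the constant `h 1`. -/
lemma IsVolIsoSplit.contDiffOn_vol (hW : IsVolIsoSplit W h f) (hC : IsC2 W) :
    ContDiffOn ℝ 2 f (Ioi 0) := by
  have hs : ContDiffOn ℝ 2 (fun t : ℝ => √t) (Ioi 0) :=
    contDiffOn_id.sqrt fun t ht => (mem_Ioi.1 ht).ne'
  have h1 := hC.comp_diagMat hs hs (fun t ht => Real.sqrt_pos.2 ht) fun t ht => Real.sqrt_pos.2 ht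
  refine (h1.sub (contDiffOn_const (c := h 1))).congr fun t ht => ?_
  have ht' := Real.sqrt_pos.2 (mem_Ioi.1 ht)
  rw [hW.apply_diagMat ht' ht', div_self ht'.ne', Real.mul_self_sqrt (mem_Ioi.1 ht).le]
  ring

lemma IsVolIsoSplit.contDiffOn_iso (hW : IsVolIsoSplit W h f) (hC : IsC2 W) :
    ContDiffOn ℝ 2 h (Ioi 0) := by
  have h1 := hC.comp_diagMat contDiffOn_id (contDiffOn_const (c := (1 : ℝ))) (fun t ht => ht)
    fun t _ => one_pos
  refine (h1.sub (hW.contDiffOn_vol hC)).congr fun t ht => ?_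
  rw [id, hW.apply_diagMat ht one_pos, div_one, mul_one]
  ring

/-- Differentiating `h(t) = h(1/t)` at `t = 1` gives `h'(1) = -h'(1)`. -/
lemma IsVolIsoSplit.deriv_one (hW : IsVolIsoSplit W h f) (hC : IsC2 W) : deriv h 1 = 0 := by
  have h1 := ((hW.contDiffOn_iso hC).hasDerivAt_deriv_deriv isOpen_Ioi (mem_Ioi.2 one_pos)).1
  have h2 : HasDerivAt (fun t => h t⁻¹) (deriv h 1 * (-(1 ^ 2)⁻¹)) 1 := by
    refine HasDerivAt.comp 1 ?_ (hasDerivAt_inv one_ne_zero)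
    rwa [inv_one]
  have h3 : h =ᶠ[nhds 1] fun t => h t⁻¹ := by
    filter_upwards [Ioi_mem_nhds one_pos] with t ht
    rw [hW.1 t ht, one_div]
  have := h1.unique (h2.congr_of_eventuallyEq h3)
  norm_num at this
  linarith

lemma RankOneConvex.segment_le {n : ℕ} {W : Mat n → ℝ} (hR : RankOneConvex W) {F₁ F₂ : Mat n}
    (h₁ : F₁ ∈ GLPlus n) (h₂ : F₂ ∈ GLPlus n) (hr : (F₁ - F₂).rank = 1) {t : ℝ}
    (ht : t ∈ Ioo (0 : ℝ) 1) (h : t • F₁ + (1 - t) • F₂ ∈ GLPlus n) :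
    W (t • F₁ + (1 - t) • F₂) ≤ t * W F₁ + (1 - t) * W F₂ := by
  have := hR F₁ F₂ hr t ht
  simp only [extendTop, h₁, h₂, h, if_true] at this
  exact_mod_cast this

lemma rank_diagMat_zero {s : ℝ} (hs : s ≠ 0) : (diagMat s 0).rank = 1 := by
  have : diagMat s 0 = Matrix.diagonal ![s, 0] := by
    ext i j; fin_cases i <;> fin_cases j <;> simp [diagMat, Matrix.single]
  rw [this, Matrix.rank_diagonal, Fintype.card_eq_one_iff]
  refine ⟨⟨0, by simpa using hs⟩, fun ⟨i, hi⟩ => ?_⟩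
  fin_cases i
  · rfl
  · simp at hi

/-- Rank-one convexity along the diagonal matrices with one fixed entry. -/
lemma IsVolIsoSplit.convexOn_scale (hW : IsVolIsoSplit W h f) (hR : RankOneConvex W) {t z : ℝ}
    (ht : 0 < t) (hz : 0 < z) : ConvexOn ℝ (Ioi 0) fun s => h (s * t) + f (s * z) := by
  -- Chosen so that `p / b = t` and `p b = z`: scaling the first entry by `s` multiplies both the
  -- ratio and the determinant by `s`.
  set p := √(z * t)
  set b := √(z / t)
  have hp : 0 < p := Real.sqrt_pos.2 (by positivity)
  have hb : 0 < b := Real.sqrt_pos.2 (by positivity)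
  have hpb : p / b = t := by
    rw [← Real.sqrt_div (by positivity), show z * t / (z / t) = t ^ 2 by field_simp,
      Real.sqrt_sq ht.le]
  have hpb' : p * b = z := by
    rw [← Real.sqrt_mul (by positivity), show z * t * (z / t) = z ^ 2 by field_simp,
      Real.sqrt_sq hz.le]
  have hG : ∀ s, 0 < s → diagMat (s * p) b ∈ GLPlus 2 := fun s hs => by
    change 0 < (diagMat (s * p) b).det
    rw [det_diagMat]; positivity
  have hval : ∀ s, 0 < s → h (s * t) + f (s * z) = W (diagMat (s * p) b) := fun s hs => by
    rw [hW.apply_diagMat (by positivity) hb, mul_div_assoc, hpb, mul_assoc, hpb']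
  rw [convexOn_iff_pairwise_pos]
  refine ⟨convex_Ioi 0, fun x hx y hy hxy a c ha hc hac => ?_⟩
  obtain rfl : c = 1 - a := by linarith
  have hx' := mem_Ioi.1 hx
  have hy' := mem_Ioi.1 hy
  have hpos : 0 < a * x + (1 - a) * y := by positivity
  have hseg : a • diagMat (x * p) b + (1 - a) • diagMat (y * p) b
      = diagMat ((a * x + (1 - a) * y) * p) b := by
    simp only [diagMat]; module
  have hr : (diagMat (x * p) b - diagMat (y * p) b).rank = 1 := by
    rw [show diagMat (x * p) b - diagMat (y * p) b = diagMat ((x - y) * p) 0 by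
      simp only [diagMat]; module]
    exact rank_diagMat_zero (mul_ne_zero (sub_ne_zero.2 hxy) hp.ne')
  have := hR.segment_le (hG x hx') (hG y hy') hr ⟨ha, by linarith⟩ (hseg ▸ hG _ hpos)
  rw [hseg] at this
  simp only [smul_eq_mul]
  rwa [hval _ hpos, hval x hx', hval y hy']

/-- This is the second derivative at `s = 1` of the convex function `s ↦ h(s t) + f(s z)`. -/
lemma IsVolIsoSplit.sq_mul_deriv2_add_nonneg (hW : IsVolIsoSplit W h f) (hC : IsC2 W)
    (hR : RankOneConvex W) {t z : ℝ} (ht : 0 < t) (hz : 0 < z) :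
    0 ≤ t ^ 2 * deriv (deriv h) t + z ^ 2 * deriv (deriv f) z := by
  have hh : ∀ x : ℝ, 0 < x → _ := fun x hx =>
    (hW.contDiffOn_iso hC).hasDerivAt_deriv_deriv isOpen_Ioi (mem_Ioi.2 hx)
  have hf : ∀ x : ℝ, 0 < x → _ := fun x hx =>
    (hW.contDiffOn_vol hC).hasDerivAt_deriv_deriv isOpen_Ioi (mem_Ioi.2 hx)
  have hlin : ∀ r s : ℝ, HasDerivAt (fun s => s * r) r s := fun r s => by
    simpa using (hasDerivAt_id s).mul_const r
  refine (hW.convexOn_scale hR ht hz).nonneg_of_hasDerivAt_hasDerivAt isOpen_Ioi (x := 1)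
    (φ' := fun s => deriv h (s * t) * t + deriv f (s * z) * z) (fun s hs => ?_)
    (mem_Ioi.2 one_pos) ?_
  · have hs' := mem_Ioi.1 hs
    exact ((hh (s * t) (by positivity)).1.comp s (hlin t s)).add
      ((hf (s * z) (by positivity)).1.comp s (hlin z s))
  · have h1 : HasDerivAt (fun s => deriv h (s * t)) (deriv (deriv h) (1 * t) * t) 1 :=
      HasDerivAt.comp (h₂ := deriv h) (h := fun s => s * t) 1 (hh (1 * t) (by positivity)).2
        (hlin t 1)
    have h2 : HasDerivAt (fun s => deriv f (s * z)) (deriv (deriv f) (1 * z) * z) 1 :=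
      HasDerivAt.comp (h₂ := deriv f) (h := fun s => s * z) 1 (hf (1 * z) (by positivity)).2
        (hlin z 1)
    convert! (h1.mul_const t).add (h2.mul_const z) using 1
    rw [one_mul, one_mul]; ring

/-- A rank-one convex energy with convex isochoric part is a nonnegative multiple of the magic
energy plus a polyconvex energy. -/
theorem IsVolIsoSplit.exists_decomposition (hW : IsVolIsoSplit W h f)
    (hconv : ConvexOn ℝ (Ioi 1) h) (hC : IsC2 W) (hR : RankOneConvex W) :
    ∃ (c : ℝ) (P : Mat 2 → ℝ), 0 ≤ c ∧ HasPolyaffineSupport P ∧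
      ∀ F ∈ GLPlus 2, W F = c * magicPlus F + P F := by
  have hh : ∀ x : ℝ, 0 < x → _ := fun x hx =>
    (hW.contDiffOn_iso hC).hasDerivAt_deriv_deriv isOpen_Ioi (mem_Ioi.2 hx)
  have hf : ∀ x : ℝ, 0 < x → _ := fun x hx =>
    (hW.contDiffOn_vol hC).hasDerivAt_deriv_deriv isOpen_Ioi (mem_Ioi.2 hx)
  -- The infimum of `A` is the constant `c`: it is the largest multiple of `t - log t` that can be
  -- removed from `h` keeping convexity, and every `-z² f''(z)` is a lower bound of `A`.
  set A : Set ℝ := (fun t => t ^ 2 * deriv (deriv h) t) '' Ioi 1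
  have hA0 : ∀ r ∈ A, 0 ≤ r := by
    rintro _ ⟨t, ht, rfl⟩
    have ht' := one_pos.trans (mem_Ioi.1 ht)
    exact mul_nonneg (sq_nonneg _) (hconv.nonneg_of_hasDerivAt_hasDerivAt isOpen_Ioi
      (fun x hx => (hh x (one_pos.trans hx)).1) ht (hh t ht').2)
  have hcA : ∀ t, 1 < t → sInf A ≤ t ^ 2 * deriv (deriv h) t := fun t ht =>
    csInf_le ⟨0, hA0⟩ ⟨t, ht, rfl⟩
  have hcf : ∀ z, 0 < z → -(z ^ 2 * deriv (deriv f) z) ≤ sInf A := fun z hz => by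
    refine le_csInf (Set.Nonempty.image _ ⟨2, by norm_num⟩) ?_
    rintro _ ⟨t, ht, rfl⟩
    have := hW.sq_mul_deriv2_add_nonneg hC hR (one_pos.trans (mem_Ioi.1 ht)) hz
    simp only
    linarith
  have hc : 0 ≤ sInf A := Real.sInf_nonneg hA0
  generalize sInf A = c at hcA hcf hc
  have hG1 : ∀ t, 0 < t → HasDerivAt (fun t => h t - c * (t - Real.log t))
      (deriv h t - c * (1 - t⁻¹)) t := fun t ht =>
    (hh t ht).1.sub (((hasDerivAt_id t).sub (Real.hasDerivAt_log ht.ne')).const_mul c)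
  have hG2 : ∀ t, 0 < t → HasDerivAt (fun t => deriv h t - c * (1 - t⁻¹))
      (deriv (deriv h) t - c * (t ^ 2)⁻¹) t := fun t ht => by
    convert! (hh t ht).2.sub (((hasDerivAt_inv ht.ne').const_sub 1).const_mul c) using 1
    ring
  have hg1 : ∀ z, 0 < z → HasDerivAt (fun z => f z - c * Real.log z)
      (deriv f z - c * z⁻¹) z := fun z hz =>
    (hf z hz).1.sub ((Real.hasDerivAt_log hz.ne').const_mul c)
  have hg2 : ∀ z, 0 < z → HasDerivAt (fun z => deriv f z - c * z⁻¹)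
      (deriv (deriv f) z + c * (z ^ 2)⁻¹) z := fun z hz => by
    convert! (hf z hz).2.sub ((hasDerivAt_inv hz.ne').const_mul c) using 1
    ring
  have hGc : ConvexOn ℝ (Ici 1) fun t => h t - c * (t - Real.log t) := by
    refine convexOn_of_hasDerivWithinAt2_nonneg (convex_Ici 1)
      (fun t ht => (hG1 t (one_pos.trans_le ht)).continuousAt.continuousWithinAt)
      (fun t ht => (hG1 t (one_pos.trans_le (interior_subset ht : t ∈ Ici 1))).hasDerivWithinAt)
      (fun t ht => (hG2 t (one_pos.trans_le (interior_subset ht : t ∈ Ici 1))).hasDerivWithinAt)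
      fun t ht => ?_
    rw [interior_Ici] at ht
    have ht' := one_pos.trans (mem_Ioi.1 ht)
    rw [sub_nonneg, mul_inv_le_iff₀ (by positivity), mul_comm]
    exact hcA t ht
  have hgc : ConvexOn ℝ (Ioi 0) fun z => f z - c * Real.log z := by
    refine convexOn_of_hasDerivWithinAt2_nonneg (convex_Ioi 0)
      (fun z hz => (hg1 z hz).continuousAt.continuousWithinAt)
      (fun z hz => (hg1 z (interior_subset hz)).hasDerivWithinAt)
      (fun z hz => (hg2 z (interior_subset hz)).hasDerivWithinAt) fun z hz => ?_
    have hz' : 0 < z := interior_subset hz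
    have := hcf z hz'
    rw [← neg_le_iff_add_nonneg', ← div_eq_mul_inv, le_div_iff₀ (by positivity)]
    linarith
  refine ⟨c, fun F => (h (sigmaMax F / sigmaMin F) - c * (sigmaMax F / sigmaMin F
    - Real.log (sigmaMax F / sigmaMin F))) + (f F.det - c * Real.log F.det), hc,
    hasPolyaffineSupport_of_tangents (G := fun t => h t - c * (t - Real.log t))
      (g := fun z => f z - c * Real.log z) (fun t₀ ht₀ => ?_) fun z₀ hz₀ => ?_, fun F hF => ?_⟩
  · refine ⟨deriv h t₀ - c * (1 - t₀⁻¹), ?_, fun t ht =>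
      hGc.add_mul_sub_le ht₀ ht (hG1 t₀ (one_pos.trans_le ht₀))⟩
    rcases ht₀.eq_or_lt with rfl | hlt
    -- At `t₀ = 1` the slope vanishes. For `t₀ > 1`, the tangents at `1` (horizontal) and at `t₀`
    -- would contradict each other if the latter had negative slope.
    · simp [hW.deriv_one hC]
    · have e1 := hGc.add_mul_sub_le (mem_Ici.2 le_rfl) ht₀ (hG1 1 one_pos)
      have e2 := hGc.add_mul_sub_le ht₀ (mem_Ici.2 le_rfl) (hG1 t₀ (one_pos.trans hlt))
      rw [hW.deriv_one hC] at e1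
      norm_num only [inv_one, sub_self, mul_zero, zero_mul, add_zero] at e1
      by_contra! hneg
      have := mul_pos_of_neg_of_neg hneg (sub_neg.2 hlt)
      norm_num at e1 e2
      linarith
  · exact ⟨_, fun z hz => hgc.add_mul_sub_le hz₀ hz (hg1 z₀ hz₀)⟩
  · rw [hW.2 F hF, sigmaMax_mul_sigmaMin hF, magicPlus]
    ring

end Split

end PlanarEnergy

theorem lemma4p1 :
    PlanarEnergy.RankOneConvex PlanarEnergy.magicPlus ∧
      ((∃ W : PlanarEnergy.Mat 2 → ℝ, PlanarEnergy.IsC2 W ∧ W ∈ PlanarEnergy.MPlus ∧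
          PlanarEnergy.RankOneConvex W ∧ ¬ PlanarEnergy.Quasiconvex W) ↔
        ¬ PlanarEnergy.Quasiconvex PlanarEnergy.magicPlus) := by
  refine ⟨PlanarEnergy.rankOneConvex_magicPlus, ?_, fun h => ⟨PlanarEnergy.magicPlus,
    PlanarEnergy.isC2_magicPlus, PlanarEnergy.magicPlus_mem_MPlus,
    PlanarEnergy.rankOneConvex_magicPlus, h⟩⟩
  rintro ⟨W, hC, ⟨h, f, hW, hconv⟩, hR, hQ⟩ hmagic
  obtain ⟨c, P, hc, hP, hdec⟩ := hW.exists_decomposition hconv hC hR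
  exact hQ (PlanarEnergy.Quasiconvex.of_magicPlus hc hP hdec hmagic)
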